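/- Jobs $1,\dots,n$ ($n$ even) are processed on a single machine from time $0$ on. Job $j$, if started at time $s_j\ge 0$, occupies the machine during $[s_j,s_j+p]$ and, after an exact delay of $p$, during $[s_j+2p,\,s_j+2p+b_j]$; its completion time is $C_j=s_j+2p+b_j$, its due date is $d_j$ and its lateness is $C_j-d_j$. In a schedule the machine processes at most one task at a time, and every job is interlaced with at most one other job (two jobs are interlaced if one starts exactly $p$ after the other), so that a schedule consists of interlaced pairs and single jobs (this is automatic if all $b_j>0$). The interlaced pair $(x,y)$ has $s_y=s_x+p$ and takes $3p+b_y$ time units. Assume that $p>0$, that there are no long jobs, i.e. $0\le b_j\le p$ for all $j$, and the disagreeable case $d_1\le\dots\le d_n$ and $b_1\ge\dots\ge b_n$. Let $L_{\max}$ be given, let $S$ be a shortest schedule (one of minimum makespan) among the schedules with maximum lateness at most $L_{\max}$, and let $C_{\max}$ be the makespan of $S$. Let $k^*$ be the largest $k\in\{0,\dots,n-1\}$ with $C_{\max}-d_{n-k}\le L_{\max}$, and $i^*$ the largest $i$ with $k^*<i\le n-1$ and $C_{\max}-p-b_{n-k^*}+b_{n-i}-d_{n-i}\le L_{\max}$;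 suppose that both exist. For integers $\alpha,\beta\ge 0$ with $\alpha+2\beta+1=i^*$ and $i^*+\alpha\le n-1$ the trim $\mathcal S_{\alpha,\beta}=P_\alpha S_\beta$ is the sequence of $\alpha+\beta+1$ interlaced pairs $$(n-i^*-\alpha,\,y_0)\,(n-i^*-\alpha+1,\,y_1)\cdots(n-i^*+\beta,\,y_{\alpha+\beta}),\qquad \{y_0,\dots,y_{\alpha+\beta}\}=\{n-i^*+\beta+1,\dots,n\},$$ where $y_0>\dots>y_{\alpha+\beta}$ if $\beta+1\ge i^*-k^*$, and $y_{\alpha+\beta}=n-k^*$, $y_0>\dots>y_{\alpha+\beta-1}$ if $\beta+1<i^*-k^*$. Its first $\alpha$ pairs form $P_\alpha$ and its last $\beta+1$ pairs form the end $S_\beta$. The trim is feasible if, processed without idle time and completed at time $C_{\max}$, all its jobs have lateness at most $L_{\max}$. It is optimal if it is feasible and $\alpha$ is maximum among the feasible trims. Then an optimal trim $\mathcal S_{\alpha^*,\beta^*}$ exists, and $S$ may be chosen, among the shortest schedules with maximum lateness at most $L_{\max}$, so that it ends with the optimal end $S_{\beta^*}$: the pairs of $S_{\beta^*}$ are processed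 consecutively without idle time and completed at $C_{\max}$, and all other jobs are completed before they start. -/

import Mathlib

/-- Data of an instance of the coupled-task problem `1 | (p, p, b_j) | L_max`. The jobs are
`1, …, n`; both the first task and the exact delay of every job last `p`, the second task of
job `j` lasts `b j`, and `d j` is the due date of job `j`. (Values of `b`, `d` outside
`1, …, n` play no role.) -/
structure CoupledInstance where
  n : ℕ
  p : ℝ
  b : ℕ → ℝ
  d : ℕ → ℝ

namespace CoupledInstance

/-- The set of jobs `1, …, n`. -/
def jobs (I : CoupledInstance) : Finset ℕ := Finset.Icc 1 I.n

/-- The disagreeable case without long jobs, for jobs numbered in EDD order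
`d 1 ≤ … ≤ d n`, which is then an LPT order `b 1 ≥ … ≥ b n`. -/
structure IsDisagreeableNoLong (I : CoupledInstance) : Prop where
  p_pos : 0 < I.p
  b_nonneg : ∀ j ∈ I.jobs, 0 ≤ I.b j
  b_le_p : ∀ j ∈ I.jobs, I.b j ≤ I.p
  edd : ∀ i ∈ I.jobs, ∀ j ∈ I.jobs, i ≤ j → I.d i ≤ I.d j
  lpt : ∀ i ∈ I.jobs, ∀ j ∈ I.jobs, i ≤ j → I.b j ≤ I.b i

/-- Completion time of job `j` in the schedule in which every job `i` starts at time `s i`. -/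
def completion (I : CoupledInstance) (s : ℕ → ℝ) (j : ℕ) : ℝ := s j + 2 * I.p + I.b j

/-- The time intervals `[a, a + u]` and `[c, c + v]` do not overlap: one of them ends before
the other one starts. -/
def NoOverlap (a u c v : ℝ) : Prop := a + u ≤ c ∨ c + v ≤ a

/-- `s` (the start times of the jobs) is a schedule on a single machine. Job `j` occupies the
machine during `[s j, s j + p]` and, after a delay of exactly `p`, during
`[s j + 2 p, s j + 2 p + b j]`.

Two jobs are interlaced when one of them starts `p` time units after the other. Clause
`no_chain` says that a job is interlaced with at most one other job, so that a schedule is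
composed of pairs of interlaced jobs and of single jobs. It follows from the other clauses as
soon as all `b j` are positive; it only matters for second tasks of length zero. -/
structure IsSchedule (I : CoupledInstance) (s : ℕ → ℝ) : Prop where
  start_nonneg : ∀ j ∈ I.jobs, 0 ≤ s j
  first_first : ∀ i ∈ I.jobs, ∀ j ∈ I.jobs, i ≠ j → NoOverlap (s i) I.p (s j) I.p
  first_second : ∀ i ∈ I.jobs, ∀ j ∈ I.jobs, i ≠ j →
    NoOverlap (s i) I.p (s j + 2 * I.p) (I.b j)
  second_second : ∀ i ∈ I.jobs, ∀ j ∈ I.jobs, i ≠ j →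
    NoOverlap (s i + 2 * I.p) (I.b i) (s j + 2 * I.p) (I.b j)
  no_chain : ∀ i ∈ I.jobs, ∀ j ∈ I.jobs, ∀ k ∈ I.jobs,
    ¬ (s j = s i + I.p ∧ s k = s j + I.p)

/-- The maximum lateness of `s` does not exceed `L`. -/
def MaxLatenessLE (I : CoupledInstance) (s : ℕ → ℝ) (L : ℝ) : Prop :=
  ∀ j ∈ I.jobs, I.completion s j - I.d j ≤ L

/-- `C` is the makespan of `s`, i.e. the largest completion time of a job. -/
def IsMakespan (I : CoupledInstance) (s : ℕ → ℝ) (C : ℝ) : Prop :=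
  IsGreatest {t | ∃ j ∈ I.jobs, t = I.completion s j} C

/-- `s` is a shortest schedule with maximum lateness (not exceeding) `L`, and its makespan
is `C`. -/
structure IsShortest (I : CoupledInstance) (s : ℕ → ℝ) (L C : ℝ) : Prop where
  isSchedule : I.IsSchedule s
  lateness : I.MaxLatenessLE s L
  makespan : I.IsMakespan s C
  shortest : ∀ s' C', I.IsSchedule s' → I.MaxLatenessLE s' L → I.IsMakespan s' C' → C ≤ C'

/-- `k` is the first pivotal number `k*` for the makespan `C` and the maximum lateness `L`. -/
def IsPivotK (I : CoupledInstance) (L C : ℝ) (k : ℕ) : Prop :=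
  IsGreatest {k : ℕ | k < I.n ∧ C - I.d (I.n - k) ≤ L} k

/-- `i` is the second pivotal number `i*`, where `k` is the first one. -/
def IsPivotI (I : CoupledInstance) (L C : ℝ) (k i : ℕ) : Prop :=
  IsGreatest {i : ℕ | k < i ∧ i < I.n ∧
    C - I.p - I.b (I.n - k) + I.b (I.n - i) - I.d (I.n - i) ≤ L} i

/-! ### Sequences of interlaced pairs

A sequence of `m` pairs `(x 0, y 0) … (x (m-1), y (m-1))` is given by `x y : ℕ → ℕ`. In the pair
`(x r, y r)` job `x r` starts first and `y r` starts `p` later, so that the pair takes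
`3 p + b (y r)`. -/

/-- Start time of the `r`-th pair when the sequence is processed without idle time and is
completed at time `C`. -/
def pairStart (I : CoupledInstance) (C : ℝ) (y : ℕ → ℕ) (m r : ℕ) : ℝ :=
  C - ∑ q ∈ Finset.Ico r m, (3 * I.p + I.b (y q))

/-- The sequence has maximum lateness not exceeding `L` when completed at time `C`. -/
def PairsFeasible (I : CoupledInstance) (L C : ℝ) (x y : ℕ → ℕ) (m : ℕ) : Prop :=
  ∀ r < m, I.pairStart C y m r + 2 * I.p + I.b (x r) - I.d (x r) ≤ L ∧
    I.pairStart C y m r + 3 * I.p + I.b (y r) - I.d (y r) ≤ L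

/-- The schedule `s` ends with the sequence, completed at time `C`: the pairs are processed
consecutively without idle time, and all other jobs are completed before they start. -/
def EndsWith (I : CoupledInstance) (s : ℕ → ℝ) (C : ℝ) (x y : ℕ → ℕ) (m : ℕ) : Prop :=
  (∀ r < m, s (x r) = I.pairStart C y m r ∧ s (y r) = I.pairStart C y m r + I.p) ∧
    ∀ j ∈ I.jobs, (∀ r < m, j ≠ x r ∧ j ≠ y r) → I.completion s j ≤ I.pairStart C y m 0

/-- First jobs `n - i - α, n - i - α + 1, …` of the pairs of a trim. -/
def trimFirst (I : CoupledInstance) (i α : ℕ) (r : ℕ) : ℕ := I.n - i - α + r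

/-- Second jobs of the pairs of the trim with parameters `α`, `β`. If `i - k ≤ β + 1` they are
`n, n - 1, …, n - α - β`. Otherwise, they are the jobs `n, n - 1, …, n - α - β` in this order,
except that job `n - k` is taken out and put last (see `trimSecond_spec`). -/
def trimSecond (I : CoupledInstance) (k i α β : ℕ) (r : ℕ) : ℕ :=
  if i ≤ β + 1 + k then I.n - r
  else if r = α + β then I.n - k
  else if r < k then I.n - r
  else I.n - (r + 1)

/-- In the case `β + 1 < i - k`, the second jobs `y 0, …, y (α + β)` of the trim are determined
by `y (α + β) = n - k`, `y 0 > … > y (α + β - 1)` and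
`{y 0, …, y (α + β)} = {n - i + β + 1, …, n}`. -/
theorem trimSecond_spec (I : CoupledInstance) (k i α β : ℕ) (hi : α + 2 * β + 1 = i)
    (hn : i + α < I.n) (h : β + 1 + k < i) :
    I.trimSecond k i α β (α + β) = I.n - k ∧
    (∀ r r', r < r' → r' < α + β → I.trimSecond k i α β r' < I.trimSecond k i α β r) ∧
    (Finset.range (α + β + 1)).image (I.trimSecond k i α β)
      = Finset.Icc (I.n - i + β + 1) I.n := by
  refine ⟨?_, ?_, ?_⟩
  · unfold trimSecond
    rw [if_neg (by omega), if_pos rfl]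
  · intro r r' h1 h2
    simp only [trimSecond]
    split_ifs <;> omega
  · ext j
    simp only [Finset.mem_image, Finset.mem_range, Finset.mem_Icc, trimSecond]
    constructor
    · rintro ⟨r, hr, rfl⟩
      split_ifs <;> omega
    · rintro ⟨h1, h2⟩
      rcases lt_trichotomy j (I.n - k) with hj | hj | hj
      · refine ⟨I.n - j - 1, by omega, ?_⟩
        rw [if_neg (by omega), if_neg (by omega), if_neg (by omega)]
        omega
      · refine ⟨α + β, by omega, ?_⟩
        rw [if_neg (by omega), if_pos rfl, hj]
      · refine ⟨I.n - j, by omega, ?_⟩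
        rw [if_neg (by omega), if_neg (by omega), if_pos (by omega)]
        omega

/-- `α`, `β` are parameters of a trim `P_α S_β` (of `α + β + 1` pairs), and this trim is
feasible: completed at time `C`, it has maximum lateness not exceeding `L`. -/
def IsFeasibleTrim (I : CoupledInstance) (L C : ℝ) (k i α β : ℕ) : Prop :=
  α + 2 * β + 1 = i ∧ i + α < I.n ∧
    I.PairsFeasible L C (I.trimFirst i α) (I.trimSecond k i α β) (α + β + 1)

/-- The trim with parameters `α`, `β` is optimal: it is feasible, with the largest `α`. -/
def IsOptimalTrim (I : CoupledInstance) (L C : ℝ) (k i α β : ℕ) : Prop :=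
  I.IsFeasibleTrim L C k i α β ∧ ∀ α' β', I.IsFeasibleTrim L C k i α' β' → α' ≤ α

/-- The schedule `s` ends with `S_β`, the last `β + 1` pairs of the trim `P_α S_β`, completed
at time `C`. -/
def EndsWithTrimEnd (I : CoupledInstance) (s : ℕ → ℝ) (C : ℝ) (k i α β : ℕ) : Prop :=
  I.EndsWith s C (fun r => I.trimFirst i α (α + r)) (fun r => I.trimSecond k i α β (α + r))
    (β + 1)

end CoupledInstance

/-! Schedules are first replaced by arrangements of all jobs in `m = n / 2` interlaced pairs
processed without idle time from `0` on. Pairing consecutive jobs in the order of their start times,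
the smaller number first, gives a feasible arrangement that is no longer
(`IsSchedule.exists_arrangement`); conversely every feasible arrangement is a schedule
(`Follows.isSchedule`). So `C` is also the least length of a feasible arrangement. In the
disagreeable case the latest start `F j` is nondecreasing and `b j` nonincreasing in `j`.

An arrangement is coded as a permutation `g`: positions `1, …, m` hold the first jobs in the order
of time, positions `2 m, …, m + 1` the second jobs. Large jobs in second positions make the pairs
short, so exchanges towards the identity tend to preserve feasibility; they increase the weight `∑ w
* g w`. Take a feasible arrangement of length `C` of maximal weight, and put `K = n - k*`, `M = n -
i*`, `t = g m`. As no exchange is left, first jobs increase, the second jobs from `M` on are sorted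
apart from the last one (`IsMaximal.isSorted`), and the first jobs from `M` on are exactly `M, …, t`
(`IsMaximal.first_iff`). Hence the last `t - M + 1` pairs are the end of the trim whose last first
job is `t` (`IsSorted.eq_endSecond`).

Since `β = t - M` and `α = i* - 1 - 2 β`, the largest `α` belongs to the smallest `t`. The trim for
`t` is feasible by a counting argument (`IsMaximal.isFeasibleTrim`). If the trim for `t - 1` were
feasible, a cyclic relabelling that turns job `t` into a second job would lead to a feasible
arrangement of larger weight (`IsMaximal.not_isFeasibleTrim_pred`). Smaller values are excluded
because feasibility of trims is monotone in `t` (`IsFeasibleTrim.of_le`). -/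

/-- Jobs `1, …, 2 m` are to be arranged in `m` interlaced pairs. Job `j` must not start later
than `F j`. -/
structure PairProblem where
  m : ℕ
  p : ℝ
  b : ℕ → ℝ
  F : ℕ → ℝ
  p_pos : 0 < p
  b_nonneg : ∀ j, 1 ≤ j → j ≤ 2 * m → 0 ≤ b j
  b_le : ∀ j, 1 ≤ j → j ≤ 2 * m → b j ≤ p
  b_anti : ∀ i j, 1 ≤ i → i ≤ j → j ≤ 2 * m → b j ≤ b i
  F_mono : ∀ i j, 1 ≤ i → i ≤ j → j ≤ 2 * m → F i ≤ F j

/-! ### Arrangements, their weight, and exchanges of two positions. -/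

namespace PairProblem

/-- A bijection `g` of `1, …, 2 m`. Its `r`-th pair is `(g (r + 1), g (2 m - r))`, `r < m`. -/
structure IsArrangement (P : PairProblem) (g : ℕ → ℕ) : Prop where
  one_le : ∀ w, 1 ≤ w → w ≤ 2 * P.m → 1 ≤ g w
  le : ∀ w, 1 ≤ w → w ≤ 2 * P.m → g w ≤ 2 * P.m
  inj : ∀ u w, 1 ≤ u → u ≤ 2 * P.m → 1 ≤ w → w ≤ 2 * P.m → g u = g w → u = w

/-- Start time of the `r`-th pair when the pairs are processed without idle time from `0` on. -/
def pairTime (P : PairProblem) (g : ℕ → ℕ) (r : ℕ) : ℝ :=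
  ∑ q ∈ Finset.range r, (3 * P.p + P.b (g (2 * P.m - q)))

structure IsFeasible (P : PairProblem) (g : ℕ → ℕ) : Prop where
  arr : P.IsArrangement g
  first : ∀ r < P.m, P.pairTime g r ≤ P.F (g (r + 1))
  second : ∀ r < P.m, P.pairTime g r + P.p ≤ P.F (g (2 * P.m - r))

/-- The potential that is increased by the exchanges. -/
def weight (P : PairProblem) (g : ℕ → ℕ) : ℕ := ∑ w ∈ Finset.Icc 1 (2 * P.m), w * g w

variable {P : PairProblem} {g g' : ℕ → ℕ}

theorem IsArrangement.image_eq (hg : P.IsArrangement g) :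
    (Finset.Icc 1 (2 * P.m)).image g = Finset.Icc 1 (2 * P.m) := by
  apply Finset.eq_of_subset_of_card_le
  · intro j hj
    simp only [Finset.mem_image, Finset.mem_Icc] at hj ⊢
    obtain ⟨w, hw, rfl⟩ := hj
    exact ⟨hg.one_le w hw.1 hw.2, hg.le w hw.1 hw.2⟩
  · rw [Finset.card_image_of_injOn]
    intro u hu w hw h
    simp only [Finset.coe_Icc, Set.mem_Icc] at hu hw
    exact hg.inj u w hu.1 hu.2 hw.1 hw.2 h

theorem IsArrangement.surj (hg : P.IsArrangement g) {j : ℕ} (h1 : 1 ≤ j) (h2 : j ≤ 2 * P.m) :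
    ∃ w, 1 ≤ w ∧ w ≤ 2 * P.m ∧ g w = j := by
  have : j ∈ (Finset.Icc 1 (2 * P.m)).image g := by
    rw [hg.image_eq]; simp [h1, h2]
  simp only [Finset.mem_image, Finset.mem_Icc] at this
  obtain ⟨w, hw, e⟩ := this
  exact ⟨w, hw.1, hw.2, e⟩

theorem IsArrangement.sum_eq (hg : P.IsArrangement g) :
    ∑ w ∈ Finset.Icc 1 (2 * P.m), (g w : ℤ) = ∑ j ∈ Finset.Icc 1 (2 * P.m), (j : ℤ) := by
  conv_rhs => rw [← hg.image_eq]
  rw [Finset.sum_image]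
  intro u hu w hw h
  simp only [Finset.coe_Icc, Set.mem_Icc] at hu hw
  exact hg.inj u w hu.1 hu.2 hw.1 hw.2 h

/-- Both arrangements have the same sum of values, so the factor `w` in the weight may be replaced
by `w - c`; the difference of the weights then becomes a sum of nonnegative terms. -/
theorem weight_lt (hg : P.IsArrangement g) (hg' : P.IsArrangement g') (c : ℤ)
    (h : ∀ w, 1 ≤ w → w ≤ 2 * P.m → 0 ≤ ((w : ℤ) - c) * ((g' w : ℤ) - g w))
    (h' : ∃ w, 1 ≤ w ∧ w ≤ 2 * P.m ∧ 0 < ((w : ℤ) - c) * ((g' w : ℤ) - g w)) :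
    P.weight g < P.weight g' := by
  have key : 0 < ∑ w ∈ Finset.Icc 1 (2 * P.m), ((w : ℤ) - c) * ((g' w : ℤ) - g w) := by
    apply Finset.sum_pos'
    · intro w hw
      simp only [Finset.mem_Icc] at hw
      exact h w hw.1 hw.2
    · obtain ⟨w, h1, h2, h3⟩ := h'
      exact ⟨w, by simp [h1, h2], h3⟩
  have e : ∑ w ∈ Finset.Icc 1 (2 * P.m), ((w : ℤ) - c) * ((g' w : ℤ) - g w)
      = (P.weight g' : ℤ) - P.weight g := by
    have : ∀ w ∈ Finset.Icc 1 (2 * P.m), ((w : ℤ) - c) * ((g' w : ℤ) - g w)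
        = ((w : ℤ) * g' w - w * g w) - (c * g' w - c * g w) := by intros; ring
    rw [Finset.sum_congr rfl this]
    simp only [Finset.sum_sub_distrib, ← Finset.mul_sum, hg.sum_eq, hg'.sum_eq, weight]
    push_cast
    ring
  rw [e] at key
  omega

theorem IsArrangement.weight_le (hg : P.IsArrangement g) :
    P.weight g ≤ ∑ w ∈ Finset.Icc 1 (2 * P.m), w * (2 * P.m) := by
  apply Finset.sum_le_sum
  intro w hw
  simp only [Finset.mem_Icc] at hw
  exact Nat.mul_le_mul_left _ (hg.le w hw.1 hw.2)

/-- A nonempty set of arrangements has an element of maximal weight. -/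
theorem exists_max_weight (Q : (ℕ → ℕ) → Prop) (hQ : ∀ g, Q g → P.IsArrangement g)
    (h : ∃ g, Q g) : ∃ g, Q g ∧ ∀ g', Q g' → P.weight g' ≤ P.weight g := by
  classical
  have hb : BddAbove {x | ∃ g, Q g ∧ P.weight g = x} :=
    ⟨_, by rintro x ⟨g, hg, rfl⟩; exact (hQ g hg).weight_le⟩
  obtain ⟨g₀, h₀⟩ := h
  obtain ⟨g, hg, e⟩ := Nat.sSup_mem (s := {x | ∃ g, Q g ∧ P.weight g = x}) ⟨_, g₀, h₀, rfl⟩ hb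
  exact ⟨g, hg, fun g' hg' => e ▸ le_csSup hb ⟨g', hg', rfl⟩⟩

theorem swap_cases (g : ℕ → ℕ) (u w v : ℕ) :
    v = u ∧ (g ∘ Equiv.swap u w) v = g w ∨ v = w ∧ (g ∘ Equiv.swap u w) v = g u ∨
      v ≠ u ∧ v ≠ w ∧ (g ∘ Equiv.swap u w) v = g v := by
  by_cases h1 : v = u
  · left; simp [h1]
  · by_cases h2 : v = w
    · right; left; simp [h2]
    · right; right
      simp [h1, h2, Equiv.swap_apply_of_ne_of_ne]

theorem IsArrangement.swap (hg : P.IsArrangement g) {u w : ℕ} (hu : 1 ≤ u) (hu' : u ≤ 2 * P.m)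
    (hw : 1 ≤ w) (hw' : w ≤ 2 * P.m) : P.IsArrangement (g ∘ Equiv.swap u w) := by
  have key : ∀ v, 1 ≤ v → v ≤ 2 * P.m →
      1 ≤ Equiv.swap u w v ∧ Equiv.swap u w v ≤ 2 * P.m := by
    intro v h1 h2
    rw [Equiv.swap_apply_def]
    split_ifs <;> omega
  refine ⟨fun v h1 h2 => ?_, fun v h1 h2 => ?_, fun v v' h1 h2 h3 h4 h => ?_⟩
  · exact hg.one_le _ (key v h1 h2).1 (key v h1 h2).2
  · exact hg.le _ (key v h1 h2).1 (key v h1 h2).2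
  · exact (Equiv.swap u w).injective
      (hg.inj _ _ (key v h1 h2).1 (key v h1 h2).2 (key v' h3 h4).1 (key v' h3 h4).2 h)

theorem IsArrangement.weight_swap (hg : P.IsArrangement g) {u w : ℕ} (hu : 1 ≤ u) (huw : u < w)
    (hw : w ≤ 2 * P.m) (h : g w < g u) : P.weight g < P.weight (g ∘ Equiv.swap u w) := by
  have hp : 0 < ((w : ℤ) - u) * ((g u : ℤ) - g w) :=
    mul_pos (by omega) (by omega)
  apply weight_lt hg (hg.swap hu (by omega) (by omega) hw) u
  · intro v _ _
    rcases swap_cases g u w v with ⟨e, e'⟩ | ⟨e, e'⟩ | ⟨_, _, e'⟩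
    · subst e; simp
    · subst e; rw [e']; exact hp.le
    · rw [e']; simp
  · refine ⟨w, by omega, hw, ?_⟩
    rcases swap_cases g u w w with ⟨e, e'⟩ | ⟨e, e'⟩ | ⟨_, h2, e'⟩
    · omega
    · rw [e']; exact hp
    · exact absurd rfl h2

theorem pairTime_succ (r : ℕ) :
    P.pairTime g (r + 1) = P.pairTime g r + (3 * P.p + P.b (g (2 * P.m - r))) := by
  simp [pairTime, Finset.sum_range_succ]

theorem IsArrangement.b_second (hg : P.IsArrangement g) {w : ℕ} (h1 : 1 ≤ w) (h2 : w ≤ 2 * P.m) :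
    0 ≤ P.b (g w) ∧ P.b (g w) ≤ P.p :=
  ⟨P.b_nonneg _ (hg.one_le _ h1 h2) (hg.le _ h1 h2), P.b_le _ (hg.one_le _ h1 h2) (hg.le _ h1 h2)⟩

theorem IsArrangement.pairTime_add_le (hg : P.IsArrangement g) {r s : ℕ} (hrs : r ≤ s)
    (hs : s ≤ P.m) : P.pairTime g r + 3 * P.p * (s - r : ℕ) ≤ P.pairTime g s := by
  induction s, hrs using Nat.le_induction with
  | base => simp
  | succ s hrs ih =>
    have := ih (by omega)
    have := (hg.b_second (w := 2 * P.m - s) (by omega) (by omega)).1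
    rw [pairTime_succ, Nat.succ_sub hrs]
    push_cast
    linarith

theorem IsArrangement.pairTime_mono (hg : P.IsArrangement g) {r s : ℕ} (hrs : r ≤ s)
    (hs : s ≤ P.m) : P.pairTime g r ≤ P.pairTime g s := by
  have := hg.pairTime_add_le hrs hs
  have : 0 ≤ 3 * P.p * (s - r : ℕ) := by have := P.p_pos; positivity
  linarith

/-- Only second jobs determine the lengths of pairs, and larger job numbers have shorter second
tasks. -/
theorem pairTime_le_of_le (hg : P.IsArrangement g) (hg' : P.IsArrangement g')
    (h : ∀ w, P.m < w → w ≤ 2 * P.m → g w ≤ g' w) {r : ℕ} (hr : r ≤ P.m) :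
    P.pairTime g' r ≤ P.pairTime g r := by
  apply Finset.sum_le_sum
  intro q hq
  simp only [Finset.mem_range] at hq
  have := P.b_anti _ _ (hg.one_le (2 * P.m - q) (by omega) (by omega))
    (h (2 * P.m - q) (by omega) (by omega)) (hg'.le (2 * P.m - q) (by omega) (by omega))
  linarith

/-- The larger position `w` belongs to the earlier pair. Only the pairs after that of `w`, up to
that of `u`, are shifted; beyond them the two changes cancel. -/
theorem pairTime_swap (g : ℕ → ℕ) {u w : ℕ} (hu : P.m < u) (huw : u < w) (hw : w ≤ 2 * P.m)
    {r : ℕ} (hr : r ≤ P.m) : P.pairTime (g ∘ Equiv.swap u w) r = P.pairTime g r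
      + ((if 2 * P.m - w < r then P.b (g u) - P.b (g w) else 0)
      + (if 2 * P.m - u < r then P.b (g w) - P.b (g u) else 0)) := by
  induction r with
  | zero => simp [pairTime]
  | succ r ih =>
    rw [pairTime_succ, pairTime_succ, ih (by omega)]
    rcases swap_cases g u w (2 * P.m - r) with ⟨e, e'⟩ | ⟨e, e'⟩ | ⟨h1, h2, e'⟩
    · rw [e', if_pos (by omega), if_neg (by omega), if_pos (by omega), if_pos (by omega), e]
      ring
    · rw [e', if_neg (by omega), if_neg (by omega), if_pos (by omega), if_neg (by omega), e]
      ring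
    · rw [e']
      have a1 : (2 * P.m - w < r) ↔ (2 * P.m - w < r + 1) := by omega
      have a2 : (2 * P.m - u < r) ↔ (2 * P.m - u < r + 1) := by omega
      simp only [a1, a2]
      ring

theorem pairTime_swap_le (hg : P.IsArrangement g) {u w : ℕ} (hu : P.m < u) (huw : u < w)
    (hw : w ≤ 2 * P.m) (h : g w ≤ g u) {r : ℕ} (hr : r ≤ P.m) :
    P.pairTime (g ∘ Equiv.swap u w) r ≤ P.pairTime g r := by
  rw [pairTime_swap g hu huw hw hr]
  have := P.b_anti _ _ (hg.one_le w (by omega) hw) h (hg.le u (by omega) (by omega))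
  split_ifs <;> first | linarith | omega

/-- The pair times counted from the end. -/
theorem pairTime_eq_sub (g : ℕ → ℕ) {e : ℕ} (he : e ≤ P.m) : P.pairTime g (P.m - e)
    = P.pairTime g P.m - ∑ q ∈ Finset.range e, (3 * P.p + P.b (g (P.m + 1 + q))) := by
  induction e with
  | zero => simp
  | succ e ih =>
    have h1 : P.m - e = (P.m - (e + 1)) + 1 := by omega
    have h2 : 2 * P.m - (P.m - (e + 1)) = P.m + 1 + e := by omega
    have := ih (by omega)
    rw [h1, pairTime_succ, h2] at this
    rw [Finset.sum_range_succ]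
    linarith

end PairProblem

/-! ### The pivotal jobs and the structure of arrangements of maximal weight. -/

namespace PairProblem
variable {P : PairProblem} {g g' : ℕ → ℕ}

/-- `C` is a lower bound for the makespan, `K` is the first job that may be completed at `C`, and
`M` the first job that may start the last pair if this pair is completed at `C` and its second
job is `K`. -/
structure IsPivotal (P : PairProblem) (C : ℝ) (K M : ℕ) : Prop where
  le_time : ∀ g, P.IsFeasible g → C ≤ P.pairTime g P.m
  one_le : 1 ≤ M
  lt : M < K
  le : K ≤ 2 * P.m
  second_iff : ∀ j, 1 ≤ j → j ≤ 2 * P.m → (K ≤ j ↔ C ≤ P.F j + P.b j + 2 * P.p)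
  first_iff : ∀ j, 1 ≤ j → j ≤ 2 * P.m → (M ≤ j ↔ C - 3 * P.p - P.b K ≤ P.F j)

variable {C : ℝ} {K M : ℕ}

theorem IsPivotal.b_pivot (hP : P.IsPivotal C K M) : 0 ≤ P.b K ∧ P.b K ≤ P.p := by
  have := hP.one_le
  have := hP.lt
  exact ⟨P.b_nonneg _ (by omega) hP.le, P.b_le _ (by omega) hP.le⟩

theorem IsPivotal.m_pos (hP : P.IsPivotal C K M) : 0 < P.m := by
  have := hP.one_le
  have := hP.lt
  have := hP.le
  omega

theorem IsPivotal.le_F (hP : P.IsPivotal C K M) {j : ℕ} (h1 : M ≤ j) (h2 : j ≤ 2 * P.m) {τ : ℝ}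
    (hτ : τ ≤ C - 3 * P.p - P.b K) : τ ≤ P.F j :=
  hτ.trans ((hP.first_iff j (hP.one_le.trans h1) h2).1 h1)

theorem IsPivotal.second_le_F (hP : P.IsPivotal C K M) {j : ℕ} (h1 : K ≤ j) (h2 : j ≤ 2 * P.m)
    {τ : ℝ} (hτ : τ + 3 * P.p + P.b j ≤ C) : τ + P.p ≤ P.F j := by
  have := hP.one_le
  have := hP.lt
  have := (hP.second_iff j (by omega) h2).1 h1
  linarith

/-- Because `b j ≤ p`, a first job is completed within `3 p` of the start of its pair, hence by `C`,
which is allowed from `K` on. -/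
theorem IsPivotal.first_le_F (hP : P.IsPivotal C K M) {j : ℕ} (h1 : K ≤ j) (h2 : j ≤ 2 * P.m)
    {τ : ℝ} (hτ : τ + 3 * P.p ≤ C) : τ ≤ P.F j := by
  have h0 := hP.one_le
  have h0' := hP.lt
  have := (hP.second_iff j (by omega) h2).1 h1
  have := P.b_le j (by omega) h2
  linarith

/-- No job from `M` on is late in a pair which is not the last one. -/
theorem IsPivotal.time_not_last (hP : P.IsPivotal C K M) (hg : P.IsArrangement g)
    (hC : P.pairTime g P.m ≤ C) {r : ℕ} (hr : r + 1 < P.m) :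
    P.pairTime g r + P.p ≤ C - 3 * P.p - P.b K := by
  -- Two whole pairs, at least `6 p`, have to fit before `C`, whereas the claim needs only `4 p + b
  -- K ≤ 5 p`.
  have h := hg.pairTime_add_le (r := r) (s := r + 2) (by omega) (by omega)
  have h' := hg.pairTime_mono (r := r + 2) (s := P.m) (by omega) le_rfl
  have e : r + 2 - r = 2 := by omega
  rw [e] at h
  have := hP.b_pivot
  have := P.p_pos
  push_cast at h
  linarith

theorem pairTime_last (hm : 0 < P.m) :
    P.pairTime g P.m = P.pairTime g (P.m - 1) + (3 * P.p + P.b (g (P.m + 1))) := by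
  have h := pairTime_succ (P := P) (g := g) (P.m - 1)
  have e1 : P.m - 1 + 1 = P.m := by omega
  have e2 : 2 * P.m - (P.m - 1) = P.m + 1 := by omega
  rwa [e1, e2] at h

theorem IsFeasible.second_pos (hg : P.IsFeasible g) {u : ℕ} (h1 : P.m < u) (h2 : u ≤ 2 * P.m) :
    P.pairTime g (2 * P.m - u) + P.p ≤ P.F (g u) := by
  have := hg.second (2 * P.m - u) (by omega)
  rwa [show 2 * P.m - (2 * P.m - u) = u by omega] at this

theorem IsFeasible.first_pos (hg : P.IsFeasible g) {u : ℕ} (h1 : 1 ≤ u) (h2 : u ≤ P.m) :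
    P.pairTime g (u - 1) ≤ P.F (g u) := by
  have := hg.first (u - 1) (by omega)
  rwa [show u - 1 + 1 = u by omega] at this

theorem isFeasible_of_pos (hg : P.IsArrangement g)
    (h1 : ∀ u, 1 ≤ u → u ≤ P.m → P.pairTime g (u - 1) ≤ P.F (g u))
    (h2 : ∀ u, P.m < u → u ≤ 2 * P.m → P.pairTime g (2 * P.m - u) + P.p ≤ P.F (g u)) :
    P.IsFeasible g := by
  refine ⟨hg, fun r hr => ?_, fun r hr => ?_⟩
  · simpa using h1 (r + 1) (by omega) (by omega)
  · have := h2 (2 * P.m - r) (by omega) (by omega)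
    rwa [show 2 * P.m - (2 * P.m - r) = r by omega] at this

/-- `h` arises from `g` by permuting second jobs from `M` on, without delaying any pair. -/
structure IsResorting (P : PairProblem) (K M : ℕ) (g h : ℕ → ℕ) : Prop where
  arr : P.IsArrangement h
  first_eq : ∀ w, 1 ≤ w → w ≤ P.m → h w = g w
  small_eq : ∀ w, P.m < w → w ≤ 2 * P.m → g w < M → h w = g w
  second : ∀ u, P.m < u → u ≤ 2 * P.m → P.pairTime h (2 * P.m - u) + P.p ≤ P.F (h u)
  time_le : ∀ r ≤ P.m, P.pairTime h r ≤ P.pairTime g r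
  last : K ≤ h (P.m + 1)

variable {h : ℕ → ℕ}

/-- The larger job moves to an earlier pair and has the larger bound `F`. The smaller one moves to a
later pair, where a job from `M` on is not late unless the pair is the last; there `K ≤ h w` is
needed. -/
theorem IsResorting.swap (hP : P.IsPivotal C K M) (hC : P.pairTime g P.m ≤ C)
    (hh : P.IsResorting K M g h) {u w : ℕ} (hu : P.m < u) (huw : u < w) (hw : w ≤ 2 * P.m)
    (hlt : h w < h u) (h1 : M ≤ h w) (h2 : u = P.m + 1 → K ≤ h w) :
    P.IsResorting K M g (h ∘ Equiv.swap u w) := by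
  have harr := hh.arr.swap (u := u) (w := w) (by omega) (by omega) (by omega) hw
  have htime : ∀ r ≤ P.m, P.pairTime (h ∘ Equiv.swap u w) r ≤ P.pairTime h r :=
    fun r hr => pairTime_swap_le hh.arr hu huw hw hlt.le hr
  have hC' : P.pairTime (h ∘ Equiv.swap u w) P.m ≤ C :=
    (htime _ le_rfl).trans ((hh.time_le _ le_rfl).trans hC)
  refine ⟨harr, fun v hv hv' => ?_, fun v hv hv' hs => ?_, fun v hv hv' => ?_,
    fun r hr => (htime r hr).trans (hh.time_le r hr), ?_⟩
  · rcases swap_cases h u w v with ⟨e, e'⟩ | ⟨e, e'⟩ | ⟨_, _, e'⟩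
    · omega
    · omega
    · rw [e', hh.first_eq v hv hv']
  · have hs' := hh.small_eq v hv hv' hs
    rcases swap_cases h u w v with ⟨e, e'⟩ | ⟨e, e'⟩ | ⟨_, _, e'⟩
    · subst e; omega
    · subst e; omega
    · rw [e', hs']
  · rcases swap_cases h u w v with ⟨e, e'⟩ | ⟨e, e'⟩ | ⟨_, _, e'⟩
    · subst e
      rw [e']
      have hle := hh.arr.le w (by omega) hw
      by_cases hl : v = P.m + 1
      · apply hP.second_le_F (h2 hl) hle
        have := pairTime_last (P := P) (g := h ∘ Equiv.swap v w) hP.m_pos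
        rw [← hl, e'] at this
        rw [show 2 * P.m - v = P.m - 1 by omega]
        linarith
      · exact hP.le_F h1 hle (hP.time_not_last harr hC' (by omega))
    · subst e
      rw [e']
      have a := hh.second v hv hv'
      have b := htime (2 * P.m - v) (by omega)
      have c := P.F_mono _ _ (hh.arr.one_le v (by omega) hw) hlt.le (hh.arr.le u (by omega) (by omega))
      linarith
    · rw [e']
      have a := hh.second v hv hv'
      have b := htime (2 * P.m - v) (by omega)
      linarith
  · rcases swap_cases h u w (P.m + 1) with ⟨e, e'⟩ | ⟨e, e'⟩ | ⟨_, _, e'⟩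
    · rw [e']; exact h2 e.symm
    · omega
    · rw [e']; exact hh.last

/-- The second jobs from `M` on are in decreasing order, except that the last one is the smallest
one from `K` on. -/
structure IsSorted (P : PairProblem) (K M : ℕ) (h : ℕ → ℕ) : Prop where
  arr : P.IsArrangement h
  last : K ≤ h (P.m + 1)
  last_lt : ∀ w, P.m + 1 < w → w ≤ 2 * P.m → K ≤ h w → h (P.m + 1) < h w
  lt : ∀ u w, P.m + 1 < u → u < w → w ≤ 2 * P.m → M ≤ h u → M ≤ h w → h u < h w

theorem IsResorting.isSorted (hP : P.IsPivotal C K M) (hC : P.pairTime g P.m ≤ C)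
    (hh : P.IsResorting K M g h)
    (hmax : ∀ h', P.IsResorting K M g h' → P.weight h' ≤ P.weight h) : P.IsSorted K M h := by
  have key : ∀ u w, P.m < u → u < w → w ≤ 2 * P.m → M ≤ h w →
      (u = P.m + 1 → K ≤ h w) → h u < h w := by
    intro u w hu huw hw h1 h2
    by_contra hcon
    have hne : h u ≠ h w := fun e => by
      have := hh.arr.inj u w (by omega) (by omega) (by omega) hw e
      omega
    have hlt : h w < h u := by omega
    have := hmax _ (hh.swap hP hC hu huw hw hlt h1 h2)
    have := hh.arr.weight_swap (by omega) huw hw hlt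
    omega
  have := hP.lt
  exact ⟨hh.arr, hh.last, fun w h1 h2 h3 => key _ w (by omega) h1 h2 (by omega) fun _ => h3,
    fun u w h1 h2 h3 _ h5 => key u w (by omega) h2 h3 h5 (by omega)⟩

/-- The last second job is completed exactly at `C`. -/
theorem IsFeasible.last_ge (hP : P.IsPivotal C K M) (hg : P.IsFeasible g)
    (hC : P.pairTime g P.m = C) : K ≤ g (P.m + 1) := by
  have hm := hP.m_pos
  rw [hP.second_iff _ (hg.arr.one_le _ (by omega) (by omega)) (hg.arr.le _ (by omega) (by omega))]
  have h1 := pairTime_last (P := P) (g := g) hm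
  have h2 := hg.second_pos (u := P.m + 1) (by omega) (by omega)
  rw [show 2 * P.m - (P.m + 1) = P.m - 1 by omega] at h2
  linarith

theorem IsFeasible.isResorting_self (hP : P.IsPivotal C K M) (hg : P.IsFeasible g)
    (hC : P.pairTime g P.m = C) : P.IsResorting K M g g :=
  ⟨hg.arr, fun _ _ _ => rfl, fun _ _ _ _ => rfl, fun _ h1 h2 => hg.second_pos h1 h2,
    fun _ _ => le_rfl, hg.last_ge hP hC⟩

theorem IsResorting.isFeasible (hh : P.IsResorting K M g h) (hg : P.IsFeasible g) :
    P.IsFeasible h :=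
  isFeasible_of_pos hh.arr (fun u h1 h2 => by
    rw [hh.first_eq u h1 h2]
    exact (hh.time_le _ (by omega)).trans (hg.first_pos h1 h2)) hh.second

/-- An optimal arrangement of maximal weight. -/
structure IsMaximal (P : PairProblem) (C : ℝ) (g : ℕ → ℕ) : Prop where
  feasible : P.IsFeasible g
  time_eq : P.pairTime g P.m = C
  max : ∀ g', P.IsFeasible g' → P.pairTime g' P.m ≤ C → P.weight g' ≤ P.weight g

theorem IsMaximal.isSorted (hP : P.IsPivotal C K M) (hg : P.IsMaximal C g) : P.IsSorted K M g :=
  (hg.feasible.isResorting_self hP hg.time_eq).isSorted hP hg.time_eq.le fun h' hh' =>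
    hg.max h' (hh'.isFeasible hg.feasible) ((hh'.time_le _ le_rfl).trans hg.time_eq.le)

theorem exists_isMaximal (hP : P.IsPivotal C K M) (h : ∃ g, P.IsFeasible g ∧ P.pairTime g P.m ≤ C) :
    ∃ g, P.IsMaximal C g := by
  obtain ⟨g, ⟨h1, h2⟩, h3⟩ := exists_max_weight (P := P)
    (fun g => P.IsFeasible g ∧ P.pairTime g P.m ≤ C) (fun g hg => hg.1.arr) h
  exact ⟨g, h1, le_antisymm h2 (hP.le_time g h1), fun g' a b => h3 g' ⟨a, b⟩⟩

/-- An exchange that is not available in an arrangement of maximal weight. -/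
theorem IsMaximal.not_swap (hg : P.IsMaximal C g) {u w : ℕ} (hu : 1 ≤ u) (huw : u < w)
    (hw : w ≤ 2 * P.m) (hf : P.IsFeasible (g ∘ Equiv.swap u w))
    (ht : P.pairTime (g ∘ Equiv.swap u w) P.m ≤ C) : g u < g w := by
  by_contra hcon
  have hne : g u ≠ g w := fun e => by
    have := hg.feasible.arr.inj u w (by omega) (by omega) (by omega) hw e
    omega
  have := hg.max _ hf ht
  have := hg.feasible.arr.weight_swap hu huw hw (by omega)
  omega

/-- First jobs do not influence the pair times, and of two first jobs in the wrong order the one to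
be postponed has the larger bound `F`, so they could be exchanged. -/
theorem IsMaximal.first_strictMono (hg : P.IsMaximal C g) {u w : ℕ} (hu : 1 ≤ u) (huw : u < w)
    (hw : w ≤ P.m) : g u < g w := by
  by_contra hcon
  have hga := hg.feasible.arr
  have harr := hga.swap (u := u) (w := w) (by omega) (by omega) (by omega) (by omega)
  have htime : ∀ r ≤ P.m, P.pairTime (g ∘ Equiv.swap u w) r ≤ P.pairTime g r := by
    intro r hr
    apply pairTime_le_of_le hga harr _ hr
    intro v h1 h2
    rcases swap_cases g u w v with ⟨e, e'⟩ | ⟨e, e'⟩ | ⟨_, _, e'⟩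
    · omega
    · omega
    · rw [e']
  apply hcon
  apply hg.not_swap hu huw (by omega) _ ((htime _ le_rfl).trans hg.time_eq.le)
  have hF := P.F_mono _ _ (hga.one_le w (by omega) (by omega)) (not_lt.1 hcon)
    (hga.le u (by omega) (by omega))
  apply isFeasible_of_pos harr
  · intro v h1 h2
    have a := htime (v - 1) (by omega)
    rcases swap_cases g u w v with ⟨e, e'⟩ | ⟨e, e'⟩ | ⟨_, _, e'⟩
    · rw [e', e]
      rw [e] at a
      have b := hg.feasible.first_pos (u := w) (by omega) hw
      have c := hga.pairTime_mono (r := u - 1) (s := w - 1) (by omega) (by omega)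
      linarith
    · rw [e', e]
      rw [e] at a
      have b := hg.feasible.first_pos (u := w) (by omega) hw
      linarith
    · rw [e']
      have b := hg.feasible.first_pos h1 h2
      linarith
  · intro v h1 h2
    have a := htime (2 * P.m - v) (by omega)
    rcases swap_cases g u w v with ⟨e, e'⟩ | ⟨e, e'⟩ | ⟨_, _, e'⟩
    · omega
    · omega
    · rw [e']
      have b := hg.feasible.second_pos h1 h2
      linarith

/-- Exchange of a first job with a smaller second job. -/
theorem IsFeasible.swap_first_second (hf : P.IsFeasible g) {u w : ℕ} (hu : 1 ≤ u)
    (hum : u ≤ P.m) (hw : P.m < w) (hw' : w ≤ 2 * P.m) (hlt : g w ≤ g u)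
    (hF : (∀ r ≤ P.m, P.pairTime (g ∘ Equiv.swap u w) r ≤ P.pairTime g r) →
      P.pairTime (g ∘ Equiv.swap u w) (u - 1) ≤ P.F (g w)) :
    P.IsFeasible (g ∘ Equiv.swap u w) ∧
      ∀ r ≤ P.m, P.pairTime (g ∘ Equiv.swap u w) r ≤ P.pairTime g r := by
  have hga := hf.arr
  have harr := hga.swap (u := u) (w := w) (by omega) (by omega) (by omega) (by omega)
  have htime : ∀ r ≤ P.m, P.pairTime (g ∘ Equiv.swap u w) r ≤ P.pairTime g r := by
    intro r hr
    apply pairTime_le_of_le hga harr _ hr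
    intro v h1 h2
    rcases swap_cases g u w v with ⟨e, e'⟩ | ⟨e, e'⟩ | ⟨_, _, e'⟩
    · omega
    · rw [e', e]; exact hlt
    · rw [e']
  -- Only the job that becomes a first job can get late, and `hF` covers it; the other one takes
  -- over a second position from a job whose `F` is not larger.
  refine ⟨isFeasible_of_pos harr ?_ ?_, htime⟩
  · intro v h1 h2
    have a := htime (v - 1) (by omega)
    rcases swap_cases g u w v with ⟨e, e'⟩ | ⟨e, e'⟩ | ⟨_, _, e'⟩
    · rw [e', e]; exact hF htime
    · omega
    · rw [e']
      have b := hf.first_pos h1 h2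
      linarith
  · intro v h1 h2
    have a := htime (2 * P.m - v) (by omega)
    rcases swap_cases g u w v with ⟨e, e'⟩ | ⟨e, e'⟩ | ⟨_, _, e'⟩
    · omega
    · rw [e']
      have b := hf.second_pos h1 h2
      have c := P.F_mono _ _ (hga.one_le v (by omega) (by omega)) (e ▸ hlt)
        (hga.le u (by omega) (by omega))
      linarith
    · rw [e']
      have b := hf.second_pos h1 h2
      linarith

/-- Second jobs are larger than the first jobs of their own and of all former pairs. -/
theorem IsMaximal.first_lt_second (hg : P.IsMaximal C g) {u w : ℕ} (hu : 1 ≤ u) (hum : u ≤ P.m)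
    (hw : P.m < w) (hw' : u + w ≤ 2 * P.m + 1) : g u < g w := by
  by_contra hcon
  have hga := hg.feasible.arr
  -- `u + w ≤ 2 m + 1` says that the pair of `u` is not later than that of `w`, so the exchange does
  -- not postpone `g w`.
  obtain ⟨h1, h2⟩ := hg.feasible.swap_first_second hu hum hw (by omega) (not_lt.1 hcon)
    (fun htime => by
      have a := htime (u - 1) (by omega)
      have b := hg.feasible.second_pos (u := w) hw (by omega)
      have c := hga.pairTime_mono (r := u - 1) (s := 2 * P.m - w) (by omega) (by omega)
      have := P.p_pos
      linarith)
  exact hcon (hg.not_swap hu (by omega) (by omega) h1 ((h2 _ le_rfl).trans hg.time_eq.le))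

/-- The last second job is at least `K`, hence not longer than `b K`; so the last pair starts no
earlier than `C - 3 p - b K`, and its first job meets the criterion for `M`. -/
theorem IsMaximal.le_last_first (hP : P.IsPivotal C K M) (hg : P.IsMaximal C g) :
    M ≤ g P.m := by
  have hm := hP.m_pos
  have hga := hg.feasible.arr
  have h0 := hP.one_le
  have h0' := hP.lt
  rw [hP.first_iff _ (hga.one_le _ (by omega) (by omega)) (hga.le _ (by omega) (by omega))]
  have h1 := pairTime_last (P := P) (g := g) hm
  have h2 := hg.feasible.first_pos (u := P.m) (by omega) (by omega)
  have h3 := P.b_anti _ _ (by omega) (hg.feasible.last_ge hP hg.time_eq)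
    (hga.le (P.m + 1) (by omega) (by omega))
  have := hg.time_eq
  linarith

/-- From `M` on, no second job precedes a first job. -/
theorem IsMaximal.first_of_succ (hP : P.IsPivotal C K M) (hg : P.IsMaximal C g) {u w : ℕ}
    (hu : 1 ≤ u) (hum : u ≤ P.m) (hw : P.m < w) (hw' : w ≤ 2 * P.m) (hM : M ≤ g w) :
    g u ≠ g w + 1 := by
  intro hsucc
  have hm := hP.m_pos
  have hga := hg.feasible.arr
  have hlast := hg.feasible.last_ge hP hg.time_eq
  have hsort := hg.isSorted hP
  have huw : 2 * P.m + 1 < u + w := by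
    by_contra hcon
    have := hg.first_lt_second hu hum hw (by omega)
    omega
  have hle := hga.le w (by omega) hw'
  have harr := hga.swap (u := u) (w := w) (by omega) (by omega) (by omega) (by omega)
  have hno : ∀ hf : P.IsFeasible (g ∘ Equiv.swap u w),
      ¬ ∀ r ≤ P.m, P.pairTime (g ∘ Equiv.swap u w) r ≤ P.pairTime g r := by
    intro hf ht
    have := hg.not_swap hu (by omega) hw' hf ((ht _ le_rfl).trans hg.time_eq.le)
    omega
  by_cases hul : u = P.m
  -- Outside the last pair no job from `M` on is late, so `g w` may become a first job there.
  swap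
  · obtain ⟨h1, h2⟩ := hg.feasible.swap_first_second hu hum hw hw' (by omega) (fun htime => by
      have := hP.time_not_last harr ((htime _ le_rfl).trans hg.time_eq.le) (r := u - 1) (by omega)
      have := P.p_pos
      exact hP.le_F hM hle (by linarith))
    exact hno h1 h2
  by_cases hwK : K ≤ g w
  · obtain ⟨h1, h2⟩ := hg.feasible.swap_first_second hu hum hw hw' (by omega) (fun htime => by
      apply hP.first_le_F hwK hle
      have a := (htime _ le_rfl).trans hg.time_eq.le
      have b := harr.pairTime_add_le (r := u - 1) (s := P.m) (by omega) le_rfl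
      rw [show P.m - (u - 1) = 1 by omega] at b
      push_cast at b
      linarith)
    exact hno h1 h2
  have hK0 := hP.lt
  have hKl := hP.le
  have hone := hP.one_le
  obtain ⟨v, hv1, hv2, hv⟩ := hga.surj (j := K) (by omega) (by omega)
  by_cases hvm : P.m < v
  -- Since `K` stays the last second job, the last pair starts by `C - 3 p - b K` after the
  -- exchange, which is early enough for every job from `M` on.
  · -- `K` is the last second job
    have hvl : v = P.m + 1 := by
      by_contra hne
      have := hsort.last_lt v (by omega) hv2 hv.ge
      omega
    obtain ⟨h1, h2⟩ := hg.feasible.swap_first_second hu hum hw hw' (by omega) (fun htime => by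
      apply hP.le_F hM hle
      have a := (htime _ le_rfl).trans hg.time_eq.le
      have b := pairTime_last (P := P) (g := g ∘ Equiv.swap u w) hm
      rcases swap_cases g u w (P.m + 1) with ⟨e, e'⟩ | ⟨e, e'⟩ | ⟨_, _, e'⟩
      · omega
      · exfalso
        rw [show w = v by omega] at hwK
        omega
      · rw [e', ← hvl, hv] at b
        rw [show u - 1 = P.m - 1 by omega]
        linarith)
    exact hno h1 h2
  -- Now `K` is a first job, and it is the one of the last pair because first jobs increase and `g u
  -- = g w + 1 ≤ K`. Exchanging it with `g w` alone may leave `g w` late, as the last second job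
  -- exceeds `K` and may be shorter. A second exchange makes `K` the last second job; both exchanges
  -- increase the weight.
  · have hvu : v = u := by
      by_contra hne
      have := hg.first_strictMono (u := v) (w := u) hv1 (by omega) hum
      omega
    subst hvu
    have hwl : P.m + 1 < w := by
      rcases Nat.lt_or_ge (P.m + 1) w with h | h
      · exact h
      · have : w = P.m + 1 := by omega
        rw [this] at hwK
        omega
    have hgl : K < g (P.m + 1) := by
      rcases Nat.lt_or_ge K (g (P.m + 1)) with h | h
      · exact h
      · have := hga.inj v (P.m + 1) hv1 (by omega) (by omega) (by omega) (by omega)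
        omega
    set k := (g ∘ Equiv.swap v w) with hk
    have kw : k w = K := by
      rcases swap_cases g v w w with ⟨e, e'⟩ | ⟨e, e'⟩ | ⟨_, h2, e'⟩
      · omega
      · rw [hk, e', hv]
      · exact absurd rfl h2
    have kl : k (P.m + 1) = g (P.m + 1) := by
      rcases swap_cases g v w (P.m + 1) with ⟨e, e'⟩ | ⟨e, e'⟩ | ⟨_, h2, e'⟩
      · omega
      · omega
      · rw [hk, e']
    have kv : k v = g w := by simp [hk]
    have ko : ∀ x, x ≠ v → x ≠ w → k x = g x := by
      intro x h1 h2
      rcases swap_cases g v w x with ⟨e, e'⟩ | ⟨e, e'⟩ | ⟨_, h2, e'⟩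
      · omega
      · omega
      · rw [hk, e']
    have harr' := harr.swap (u := P.m + 1) (w := w) (by omega) (by omega) (by omega) hw'
    have ht1 : ∀ r ≤ P.m, P.pairTime k r ≤ P.pairTime g r := by
      intro r hr
      apply pairTime_le_of_le hga harr _ hr
      intro x h1 h2
      by_cases hx : x = w
      · rw [hx, kw]; omega
      · rw [ko x (by omega) hx]
    have ht2 : ∀ r ≤ P.m, P.pairTime (k ∘ Equiv.swap (P.m + 1) w) r ≤ P.pairTime k r :=
      fun r hr => pairTime_swap_le harr (by omega) hwl hw' (by omega) hr
    have hC2 : P.pairTime (k ∘ Equiv.swap (P.m + 1) w) P.m ≤ C :=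
      (ht2 _ le_rfl).trans ((ht1 _ le_rfl).trans hg.time_eq.le)
    have hw1 : P.weight g < P.weight k := hga.weight_swap hu (by omega) hw' (by omega : g w < g v)
    have hw2 := harr.weight_swap (u := P.m + 1) (w := w) (by omega) hwl hw'
      (by rw [kw, kl]; exact hgl)
    have hl := pairTime_last (P := P) (g := k ∘ Equiv.swap (P.m + 1) w) hm
    have e1 : (k ∘ Equiv.swap (P.m + 1) w) (P.m + 1) = K := by simp [kw]
    rw [e1] at hl
    have hf : P.IsFeasible (k ∘ Equiv.swap (P.m + 1) w) := by
      apply isFeasible_of_pos harr'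
      · intro x h1 h2
        have a := ht1 (x - 1) (by omega)
        have b := ht2 (x - 1) (by omega)
        have e : (k ∘ Equiv.swap (P.m + 1) w) x = k x := by
          rcases swap_cases k (P.m + 1) w x with ⟨e, e'⟩ | ⟨e, e'⟩ | ⟨_, _, e'⟩
          · omega
          · omega
          · exact e'
        rw [e]
        by_cases hx : x = v
        · rw [hx, kv, hul]
          apply hP.le_F hM hle
          linarith
        · rw [ko x hx (by omega)]
          have := hg.feasible.first_pos h1 h2
          linarith
      · intro x h1 h2
        have a := ht1 (2 * P.m - x) (by omega)
        have b := ht2 (2 * P.m - x) (by omega)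
        rcases swap_cases k (P.m + 1) w x with ⟨e, e'⟩ | ⟨e, e'⟩ | ⟨_, h3, e'⟩
        · rw [e, e1]
          apply hP.second_le_F le_rfl hKl
          rw [show 2 * P.m - (P.m + 1) = P.m - 1 by omega]
          linarith
        · rw [e', kl]
          have c := hg.feasible.second_pos h1 h2
          have d := P.F_mono (g x) (g (P.m + 1)) (hga.one_le x (by omega) h2) (by rw [e]; omega)
            (hga.le _ (by omega) (by omega))
          linarith
        · rw [e', ko x (by omega) h3]
          have c := hg.feasible.second_pos h1 h2
          linarith
    have := hg.max _ hf hC2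
    omega

/-- The first jobs from `M` on are `M, …, g m`. -/
theorem IsMaximal.first_iff (hP : P.IsPivotal C K M) (hg : P.IsMaximal C g) {w : ℕ} (hw : 1 ≤ w)
    (hw' : w ≤ 2 * P.m) (hM : M ≤ g w) : w ≤ P.m ↔ g w ≤ g P.m := by
  have hm := hP.m_pos
  have hga := hg.feasible.arr
  constructor
  · intro h
    rcases h.eq_or_lt with rfl | h
    · exact le_rfl
    · exact (hg.first_strictMono hw h le_rfl).le
  · intro h
    -- Descending from `g m`: if `j + 1` is a first job and `j ≥ M`, then `j` is a first job by
    -- `first_of_succ`.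
    have key : ∀ d v, 1 ≤ v → v ≤ 2 * P.m → M ≤ g v → g v + d = g P.m → v ≤ P.m := by
      intro d
      induction d with
      | zero =>
        intro v h1 h2 _ h4
        exact (hga.inj v P.m h1 h2 (by omega) (by omega) (by omega)).le
      | succ d ih =>
        intro v h1 h2 h3 h4
        by_contra hcon
        obtain ⟨x, hx1, hx2, hx⟩ := hga.surj (j := g v + 1) (by omega) (by
          have := hga.le P.m (by omega) (by omega)
          omega)
        have := ih x hx1 hx2 (by omega) (by omega)
        exact hg.first_of_succ hP hx1 this (by omega) h2 h3 hx
    exact key (g P.m - g w) w hw hw' hM (by omega)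

end PairProblem

/-! ### Trims: their second jobs, their start times and monotonicity of feasibility. -/

/-- The sum of an antitone function over a finite set is at most the sum of its first values. -/
theorem sum_le_sum_range_of_antitone {f : ℕ → ℝ} {N : ℕ} (hf : ∀ i j, i ≤ j → j < N → f j ≤ f i)
    (h0 : ∀ i < N, 0 ≤ f i) (E : Finset ℕ) :
    ∀ k, (∀ a ∈ E, a < N) → E.card ≤ k → k ≤ N → ∑ a ∈ E, f a ≤ ∑ q ∈ Finset.range k, f q := by
  induction E using Finset.induction_on_max with
  | empty =>
    intro k _ _ hk
    simp only [Finset.sum_empty]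
    exact Finset.sum_nonneg fun i hi => h0 i (by simp at hi; omega)
  | insert a S hS ih =>
    intro k hN hk hkN
    have ha : a ∉ S := fun h => lt_irrefl _ (hS a h)
    rw [Finset.card_insert_of_notMem ha] at hk
    -- The maximum `a` is at least the number of the other elements, so `f a` is bounded by the next
    -- value `f S.card`.
    have hcard : S.card ≤ a := by
      have : S ⊆ Finset.range a := fun x hx => Finset.mem_range.2 (hS x hx)
      simpa using Finset.card_le_card this
    have haN := hN a (Finset.mem_insert_self _ _)
    have h1 := ih S.card (fun x hx => hN x (Finset.mem_insert_of_mem hx)) le_rfl (by omega)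
    have h2 := hf _ _ hcard haN
    have h3 : ∑ q ∈ Finset.range (S.card + 1), f q ≤ ∑ q ∈ Finset.range k, f q := by
      apply Finset.sum_le_sum_of_subset_of_nonneg
      · intro x hx; simp at hx ⊢; omega
      · intro i hi _
        exact h0 i (by simp at hi; omega)
    rw [Finset.sum_range_succ] at h3
    rw [Finset.sum_insert ha]
    linarith

namespace PairProblem
variable {P : PairProblem} {g g' h : ℕ → ℕ} {C : ℝ} {K M : ℕ}

/-- The second job of the `e`-th pair, counted from the end, of the trim with first jobs
`…, t - 1, t`. -/
def endSecond (K t e : ℕ) : ℕ :=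
  if K ≤ t + 1 then t + 1 + e else if e = 0 then K else if t + e < K then t + e else t + e + 1

theorem lt_endSecond (K t e : ℕ) : t < endSecond K t e := by
  unfold endSecond; split_ifs <;> omega

theorem endSecond_le {K t e n : ℕ} (hK : K ≤ n) (he : t + e + 1 ≤ n) : endSecond K t e ≤ n := by
  unfold endSecond; split_ifs <;> omega

theorem le_endSecond_zero (K t : ℕ) : K ≤ endSecond K t 0 := by
  unfold endSecond; split_ifs <;> omega

theorem endSecond_inj {K t e e' : ℕ} (h : endSecond K t e = endSecond K t e') : e = e' := by
  unfold endSecond at h; split_ifs at h <;> omega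

/-- After its entry at `0`, the sequence runs in increasing order through all other jobs larger than
`t`, so a job that has not occurred yet cannot be smaller than the current one. -/
theorem endSecond_le_of_ne {K t e z : ℕ} (hz : t < z) (he : 0 < e)
    (hne : ∀ e' < e, z ≠ endSecond K t e') : endSecond K t e ≤ z := by
  by_contra hcon
  by_cases h1 : K ≤ t + 1
  · have := hne (z - t - 1) (by simp only [endSecond, h1, if_true] at hcon; omega)
    simp only [endSecond, h1, if_true] at this
    omega
  · have h0 := hne 0 he
    simp only [endSecond, h1, if_true, if_false] at h0
    rcases lt_or_ge z K with hzK | hzK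
    · have := hne (z - t) (by simp only [endSecond, h1, if_false] at hcon; split_ifs at hcon <;> omega)
      simp only [endSecond, h1, if_false] at this
      split_ifs at this <;> omega
    · have := hne (z - t - 1)
        (by simp only [endSecond, h1, if_false] at hcon; split_ifs at hcon <;> omega)
      simp only [endSecond, h1, if_false] at this
      split_ifs at this <;> omega

/-- Among the sets of `k` jobs larger than `t` which contain a job from `K` on, the last second
jobs of the trim have maximal total length. -/
theorem sum_b_le_sum_endSecond (P : PairProblem) {K t k : ℕ} (hK : K ≤ 2 * P.m)
    (hk : t + k ≤ 2 * P.m) (A : Finset ℕ) (hA : ∀ a ∈ A, t < a ∧ a ≤ 2 * P.m) (hcard : A.card ≤ k)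
    (hlast : A.Nonempty → ∃ a ∈ A, K ≤ a) :
    ∑ a ∈ A, P.b a ≤ ∑ q ∈ Finset.range k, P.b (endSecond K t q) := by
  by_cases h1 : K ≤ t + 1
  · have key := sum_le_sum_range_of_antitone (f := fun q => P.b (t + 1 + q)) (N := 2 * P.m - t)
      (fun i j hij hj => P.b_anti _ _ (by omega) (by omega) (by omega))
      (fun i hi => P.b_nonneg _ (by omega) (by omega)) (A.image fun a => a - (t + 1)) k
      (by
        intro x hx
        simp only [Finset.mem_image] at hx
        obtain ⟨a, ha, rfl⟩ := hx
        have := hA a ha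
        omega)
      (Finset.card_image_le.trans hcard) (by omega)
    rw [Finset.sum_image (by
      intro a ha a' ha' e
      have := hA a ha
      have := hA a' ha'
      simp only at e
      omega)] at key
    have e1 : ∑ a ∈ A, P.b (t + 1 + (a - (t + 1))) = ∑ a ∈ A, P.b a :=
      Finset.sum_congr rfl fun a ha => by
        have := hA a ha
        rw [show t + 1 + (a - (t + 1)) = a by omega]
    have e2 : ∀ q, endSecond K t q = t + 1 + q := fun q => by simp [endSecond, h1]
    simp only [e2]
    rw [← e1]
    exact key
  · rcases A.eq_empty_or_nonempty with rfl | hne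
    · simp only [Finset.sum_empty]
      refine Finset.sum_nonneg fun q hq => ?_
      simp only [Finset.mem_range] at hq
      have := lt_endSecond K t q
      exact P.b_nonneg _ (by omega) (endSecond_le hK (by omega))
    -- One element from `K` on is charged to `b K`, the term at index `0`. Choosing `K` itself
    -- whenever possible makes the rest avoid `K`, so that it can be compared with the remaining
    -- terms, which skip `K`.
    obtain ⟨a₀, ha₀, hKa, hKA⟩ : ∃ a ∈ A, K ≤ a ∧ (K ∈ A → a = K) := by
      by_cases hKA : K ∈ A
      · exact ⟨K, hKA, le_rfl, fun _ => rfl⟩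
      · obtain ⟨a, ha, h⟩ := hlast hne
        exact ⟨a, ha, h, fun h => absurd h hKA⟩
    have hKn : ∀ a ∈ A.erase a₀, a ≠ K := by
      rintro a ha rfl
      have := hKA (Finset.mem_of_mem_erase ha)
      subst this
      exact absurd ha (Finset.notMem_erase _ _)
    have hA' : ∀ a ∈ A.erase a₀, t < a ∧ a ≤ 2 * P.m ∧ a ≠ K := fun a ha =>
      ⟨(hA a (Finset.mem_of_mem_erase ha)).1, (hA a (Finset.mem_of_mem_erase ha)).2, hKn a ha⟩
    have hA₀ := hA a₀ ha₀
    have hk0 : 0 < k := lt_of_lt_of_le (Finset.card_pos.2 hne) hcard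
    obtain ⟨k', rfl⟩ : ∃ k', k = k' + 1 := ⟨k - 1, by omega⟩
    have hcard' : (A.erase a₀).card ≤ k' := by
      rw [Finset.card_erase_of_mem ha₀]; omega
    have key := sum_le_sum_range_of_antitone (f := fun q => P.b (endSecond K t (q + 1)))
      (N := 2 * P.m - t - 1)
      (fun i j hij hj => P.b_anti _ _ (by have := lt_endSecond K t (i + 1); omega)
        (by unfold endSecond; split_ifs <;> omega) (endSecond_le hK (by omega)))
      (fun i hi => P.b_nonneg _ (by have := lt_endSecond K t (i + 1); omega)
        (endSecond_le hK (by omega)))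
      ((A.erase a₀).image fun a => if a < K then a - (t + 1) else a - (t + 2)) k'
      (by
        intro x hx
        simp only [Finset.mem_image] at hx
        obtain ⟨a, ha, rfl⟩ := hx
        have := hA' a ha
        split_ifs <;> omega)
      (Finset.card_image_le.trans hcard') (by omega)
    rw [Finset.sum_image (by
      intro a ha a' ha' e
      have := hA' a ha
      have := hA' a' ha'
      simp only at e
      split_ifs at e <;> omega)] at key
    have e1 : ∑ a ∈ A.erase a₀, P.b (endSecond K t
        ((if a < K then a - (t + 1) else a - (t + 2)) + 1)) = ∑ a ∈ A.erase a₀, P.b a :=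
      Finset.sum_congr rfl fun a ha => by
        have := hA' a ha
        congr 1
        rcases lt_or_ge a K with haK | haK
        · rw [if_pos haK]
          unfold endSecond
          split_ifs <;> first | omega | contradiction
        · rw [if_neg (by omega)]
          unfold endSecond
          split_ifs <;> first | omega | contradiction
    rw [e1] at key
    rw [← Finset.add_sum_erase _ _ ha₀, Finset.sum_range_succ']
    have e0 : endSecond K t 0 = K := by simp [endSecond, h1]
    rw [e0]
    have := P.b_anti K a₀ (by omega) hKa hA₀.2
    linarith

/-- Start time of the `e`-th last pair of a trim completed at time `C`. -/
def trimTime (P : PairProblem) (C : ℝ) (K t e : ℕ) : ℝ :=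
  C - ∑ q ∈ Finset.range e, (3 * P.p + P.b (endSecond K t q))

theorem trimTime_eq (P : PairProblem) (C : ℝ) (K t e : ℕ) : P.trimTime C K t e
    = C - 3 * P.p * e - ∑ q ∈ Finset.range e, P.b (endSecond K t q) := by
  simp [trimTime, Finset.sum_add_distrib]
  ring

/-- The trim with first jobs `2 t + 1 - 2 m, …, t` exists and is feasible. -/
structure IsFeasibleTrim (P : PairProblem) (C : ℝ) (K M t : ℕ) : Prop where
  m_le : P.m ≤ t
  M_le : M ≤ t
  le : 2 * t + 1 ≤ 2 * P.m + M
  first : ∀ e, t + e + 1 ≤ 2 * P.m → P.trimTime C K t (e + 1) ≤ P.F (t - e)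

theorem b_endSecond (P : PairProblem) {K t e : ℕ} (hK : K ≤ 2 * P.m) (he : t + e + 1 ≤ 2 * P.m) :
    0 ≤ P.b (endSecond K t e) ∧ P.b (endSecond K t e) ≤ P.p := by
  have := lt_endSecond K t e
  have := endSecond_le hK he
  exact ⟨P.b_nonneg _ (by omega) this, P.b_le _ (by omega) this⟩

theorem trimTime_le (P : PairProblem) {C : ℝ} {K t e : ℕ} (hK : K ≤ 2 * P.m)
    (he : t + e ≤ 2 * P.m) : P.trimTime C K t e ≤ C - 3 * P.p * e := by
  rw [trimTime_eq]
  have : 0 ≤ ∑ q ∈ Finset.range e, P.b (endSecond K t q) :=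
    Finset.sum_nonneg fun q hq => (b_endSecond P hK (by simp at hq; omega)).1
  linarith

theorem trimTime_early (hP : P.IsPivotal C K M) {t e : ℕ} (he : t + e + 1 ≤ 2 * P.m)
    (h0 : 0 < e) : P.trimTime C K t (e + 1) + P.p ≤ C - 3 * P.p - P.b K := by
  have h := trimTime_le P (C := C) hP.le (show t + (e + 1) ≤ 2 * P.m by omega)
  have := hP.b_pivot
  have := P.p_pos
  have h1 : (1 : ℝ) ≤ e := by exact_mod_cast h0
  push_cast at h
  nlinarith

/-- The second jobs of a trim are never late. -/
theorem IsPivotal.trim_second (hP : P.IsPivotal C K M) {t e : ℕ} (hM : M ≤ t)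
    (he : t + e + 1 ≤ 2 * P.m) : P.trimTime C K t (e + 1) + P.p ≤ P.F (endSecond K t e) := by
  have h1 := lt_endSecond K t e
  have h2 := endSecond_le hP.le he
  rcases Nat.eq_zero_or_pos e with rfl | h0
  · exact hP.second_le_F (le_endSecond_zero K t) h2 (by simp [trimTime]; linarith)
  · exact hP.le_F (by omega) h2 (trimTime_early hP he h0)

/-- The first jobs from `M` on of a trim are never late. -/
theorem IsPivotal.trim_first (hP : P.IsPivotal C K M) {t e : ℕ} (hM : M + e ≤ t)
    (he : t + e + 1 ≤ 2 * P.m) : P.trimTime C K t (e + 1) ≤ P.F (t - e) := by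
  rcases Nat.eq_zero_or_pos e with rfl | h0
  · have h2 := b_endSecond P (K := K) (t := t) (e := 0) hP.le he
    by_cases hK : K ≤ t
    · apply hP.first_le_F hK (by omega)
      simp only [trimTime, zero_add, Finset.sum_range_one]
      linarith
    · apply hP.le_F (by omega) (by omega)
      have : endSecond K t 0 = K := by unfold endSecond; split_ifs <;> omega
      simp only [trimTime, zero_add, Finset.sum_range_one, this]
      linarith
  · have := trimTime_early hP he h0
    have := P.p_pos
    exact hP.le_F (by omega) (by omega) (by linarith)

/-- Passing to `t + 1` puts one more pair behind each former first job, which moves it forward by at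
least `3 p`. The loss in second tasks is at most `2 p`: two of them are estimated by `p` each, and
the others do not get shorter. -/
theorem IsFeasibleTrim.succ (hP : P.IsPivotal C K M) {t : ℕ} (ht : P.IsFeasibleTrim C K M t)
    (hle : 2 * (t + 1) + 1 ≤ 2 * P.m + M) : P.IsFeasibleTrim C K M (t + 1) := by
  have h1 := ht.m_le
  have h2 := ht.M_le
  refine ⟨by omega, by omega, hle, fun e he => ?_⟩
  rcases Nat.eq_zero_or_pos e with rfl | h0
  · exact hP.trim_first (by omega) he
  obtain ⟨e, rfl⟩ : ∃ k, e = k + 1 := ⟨e - 1, by omega⟩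
  rw [show t + 1 - (e + 1) = t - e by omega]
  refine le_trans ?_ (ht.first e (by omega))
  have key : ∀ k, t + 1 + k ≤ 2 * P.m → ∑ q ∈ Finset.range (k + 1), P.b (endSecond K t q)
      ≤ 2 * P.p + ∑ q ∈ Finset.range k, P.b (endSecond K (t + 1) q) := by
    intro k hk
    have hb := fun q (hq : t + q + 1 ≤ 2 * P.m) => b_endSecond P hP.le hq
    have hb' := fun q (hq : t + 1 + q + 1 ≤ 2 * P.m) => b_endSecond P hP.le hq
    induction k with
    | zero =>
      simp
      have := hb 0 (by omega)
      have := P.p_pos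
      linarith
    | succ k ih =>
      have := ih (by omega)
      rcases Nat.eq_zero_or_pos k with rfl | hk0
      · have a := hb 0 (by omega)
        have b := hb 1 (by omega)
        have c := hb' 0 (by omega)
        simp [Finset.sum_range_succ]
        linarith
      · rw [Finset.sum_range_succ (fun q => P.b (endSecond K t q)) (k + 1),
          Finset.sum_range_succ (fun q => P.b (endSecond K (t + 1) q)) k]
        have := P.b_anti (endSecond K (t + 1) k) (endSecond K t (k + 1))
          (by have := lt_endSecond K (t + 1) k; omega)
          (by unfold endSecond; split_ifs <;> first | omega | contradiction) (endSecond_le hP.le (by omega))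
        linarith
  have hk := key e (by omega)
  have hx := b_endSecond P (K := K) (t := t + 1) (e := e) hP.le (by omega)
  have hy := b_endSecond P (K := K) (t := t + 1) (e := e + 1) hP.le (by omega)
  have := P.p_pos
  rw [trimTime_eq, trimTime_eq, Finset.sum_range_succ _ (e + 1), Finset.sum_range_succ _ e]
  push_cast
  linarith

theorem IsFeasibleTrim.of_le (hP : P.IsPivotal C K M) {t t' : ℕ} (ht : P.IsFeasibleTrim C K M t)
    (htt : t ≤ t') (hle : 2 * t' + 1 ≤ 2 * P.m + M) : P.IsFeasibleTrim C K M t' := by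
  induction t', htt using Nat.le_induction with
  | base => exact ht
  | succ s _ ih => exact (ih (by omega)).succ hP hle

/-! ### The trim given by an arrangement of maximal weight. -/

/-- Different positions with second jobs larger than `t`. -/
theorem IsArrangement.count_second (hg : P.IsArrangement g) {t e : ℕ} (he : e < P.m)
    (h : ∀ q ≤ e, t < g (P.m + 1 + q)) : t + e + 1 ≤ 2 * P.m := by
  have key := Finset.card_le_card_of_injOn (s := Finset.range (e + 1)) (t := Finset.Ioc t (2 * P.m))
    (fun q => g (P.m + 1 + q))
    (by
      intro q hq
      simp only [Finset.coe_range, Set.mem_Iio] at hq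
      simp only [Finset.coe_Ioc, Set.mem_Ioc]
      exact ⟨h q (by omega), hg.le _ (by omega) (by omega)⟩)
    (by
      intro q hq q' hq' e
      simp only [Finset.coe_range, Set.mem_Iio] at hq hq'
      have := hg.inj _ _ (by omega) (by omega) (by omega) (by omega) e
      omega)
  simp at key
  omega

/-- By `hX` and `hY` the second jobs from `M` on are precisely the jobs larger than `t`. Their order
is fixed: the smallest one from `K` on is last, and the others decrease in time. -/
theorem IsSorted.eq_endSecond (hP : P.IsPivotal C K M) (hh : P.IsSorted K M h) {t : ℕ}
    (hY : ∀ w, P.m < w → w ≤ 2 * P.m → M ≤ h w → t < h w)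
    (hX : ∀ w, 1 ≤ w → w ≤ P.m → M ≤ h w → h w ≤ t) (hM : M ≤ t) {e : ℕ} (he : e < P.m)
    (hN : ∀ q ≤ e, M ≤ h (P.m + 1 + q)) : h (P.m + 1 + e) = endSecond K t e := by
  have hK := hP.le
  induction e using Nat.strong_induction_on with
  | _ e ih =>
  have hcount := hh.arr.count_second (t := t) he
    fun q hq => hY _ (by omega) (by omega) (hN q hq)
  have hz := hY (P.m + 1 + e) (by omega) (by omega) (hN e le_rfl)
  have hzle := hh.arr.le (P.m + 1 + e) (by omega) (by omega)
  have h1 := lt_endSecond K t e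
  have h2 := endSecond_le hP.le hcount
  obtain ⟨w, hw1, hw2, hw⟩ := hh.arr.surj (j := endSecond K t e) (by omega) h2
  have hwm : P.m < w := by
    by_contra hcon
    have := hX w hw1 (by omega) (by omega)
    omega
  rcases Nat.lt_trichotomy w (P.m + 1 + e) with hlt | heq | hgt
  · have := ih (w - P.m - 1) (by omega) (by omega) fun q hq => hN q (by omega)
    rw [show P.m + 1 + (w - P.m - 1) = w by omega, hw] at this
    have := endSecond_inj this
    omega
  · rw [← heq, hw]
  · exfalso
    rcases Nat.eq_zero_or_pos e with rfl | h0
    · have hl := hh.last_lt w (by omega) hw2 (by rw [hw]; exact le_endSecond_zero K t)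
      have := hh.last
      rw [hw] at hl
      simp only [Nat.add_zero] at hz
      have e0 : endSecond K t 0 = if K ≤ t + 1 then t + 1 else K := by simp [endSecond]
      split_ifs at e0 <;> omega
    · have := hh.lt (P.m + 1 + e) w (by omega) hgt hw2 (hN e le_rfl) (by omega)
      have := endSecond_le_of_ne (K := K) hz h0 (fun e' he' hc => by
        have a := ih e' he' (by omega) fun q hq => hN q (by omega)
        rw [← a] at hc
        have := hh.arr.inj _ _ (by omega) (by omega) (by omega) (by omega) hc
        omega)
      omega

theorem IsMaximal.lt_second (hP : P.IsPivotal C K M) (hg : P.IsMaximal C g) {w : ℕ}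
    (hw : P.m < w) (hw' : w ≤ 2 * P.m) (hM : M ≤ g w) : g P.m < g w := by
  by_contra hcon
  have := (hg.first_iff hP (by omega) hw' hM).2 (by omega)
  omega

theorem IsMaximal.first_le (hg : P.IsMaximal C g) {w : ℕ} (hw : 1 ≤ w) (hw' : w ≤ P.m) :
    g w ≤ g P.m := by
  rcases hw'.eq_or_lt with rfl | h
  · exact le_rfl
  · exact (hg.first_strictMono hw h le_rfl).le

theorem IsMaximal.first_add_le (hg : P.IsMaximal C g) {e : ℕ} (he : e < P.m) :
    g (P.m - e) + e ≤ g P.m := by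
  induction e with
  | zero => simp
  | succ e ih =>
    have := ih (by omega)
    have := hg.first_strictMono (u := P.m - (e + 1)) (w := P.m - e) (by omega) (by omega) (by omega)
    omega

/-- First jobs increase in time, so an interval of first jobs below the largest one fills the last
first positions without gaps. -/
theorem IsMaximal.first_eq (hg : P.IsMaximal C g) {v : ℕ}
    (hv : ∀ j, v < j → j ≤ g P.m → ∃ w, 1 ≤ w ∧ w ≤ P.m ∧ g w = j) {e : ℕ} (he : v + e < g P.m) :
    e < P.m ∧ g (P.m - e) = g P.m - e := by
  induction e with
  | zero =>
    obtain ⟨w, h1, h2, _⟩ := hv (g P.m) (by omega) le_rfl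
    exact ⟨by omega, rfl⟩
  | succ e ih =>
    obtain ⟨h1, h2⟩ := ih (by omega)
    obtain ⟨w, hw1, hw2, hw⟩ := hv (g P.m - (e + 1)) (by omega) (by omega)
    have hlt : w < P.m - e := by
      by_contra hcon
      rcases (not_lt.1 hcon).eq_or_lt with h | h
      · rw [← h] at hw; omega
      · have := hg.first_strictMono (u := P.m - e) (w := w) (by omega) h hw2
        omega
    refine ⟨by omega, ?_⟩
    have h3 : w = P.m - (e + 1) := by
      by_contra hne
      have a := hg.first_strictMono (u := w) (w := P.m - (e + 1)) hw1 (by omega) (by omega)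
      have b := hg.first_strictMono (u := P.m - (e + 1)) (w := P.m - e) (by omega) (by omega)
        (by omega)
      omega
    rw [← h3, hw]

theorem IsMaximal.m_le (hP : P.IsPivotal C K M) (hg : P.IsMaximal C g) : P.m ≤ g P.m := by
  have hm := hP.m_pos
  have a := hg.first_add_le (e := P.m - 1) (by omega)
  have b := hg.feasible.arr.one_le (P.m - (P.m - 1)) (by omega) (by omega)
  omega

theorem IsMaximal.first_eq_of_le (hP : P.IsPivotal C K M) (hg : P.IsMaximal C g) {e : ℕ}
    (he : M + e ≤ g P.m) : e < P.m ∧ g (P.m - e) = g P.m - e := by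
  have h1 := hP.one_le
  apply hg.first_eq (v := M - 1) _ (by omega)
  intro j h2 h3
  have := hg.feasible.arr.le P.m hP.m_pos (by omega)
  obtain ⟨w, hw1, hw2, hw⟩ := hg.feasible.arr.surj (j := j) (by omega) (by omega)
  exact ⟨w, hw1, (hg.first_iff hP hw1 hw2 (by omega)).2 (by omega), hw⟩

/-- The first job of this pair is at least `M`, and its second job is larger. -/
theorem IsMaximal.second_ge (hP : P.IsPivotal C K M) (hg : P.IsMaximal C g) {e : ℕ}
    (he : M + e ≤ g P.m) : e < P.m ∧ M ≤ g (P.m + 1 + e) := by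
  obtain ⟨h1, h2⟩ := hg.first_eq_of_le hP he
  have := hg.first_lt_second (u := P.m - e) (w := P.m + 1 + e) (by omega) (by omega) (by omega)
    (by omega)
  exact ⟨h1, by omega⟩

/-- The last `g m - M + 1` pairs have distinct second jobs in `(g m, 2 m]`. In terms of the trim,
this says `α ≥ 0`. -/
theorem IsMaximal.two_mul_le (hP : P.IsPivotal C K M) (hg : P.IsMaximal C g) :
    2 * g P.m + 1 ≤ 2 * P.m + M := by
  have hM := hg.le_last_first hP
  have := hg.feasible.arr.count_second (t := g P.m) (e := g P.m - M)
    (hg.second_ge hP (e := g P.m - M) (by omega)).1 fun q hq => by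
      obtain ⟨a, b⟩ := hg.second_ge hP (e := q) (by omega)
      exact hg.lt_second hP (by omega) (by omega) b
  omega

/-- The second jobs of the last pairs are at most as long as those of the trim, apart from those
before `M`. -/
theorem IsMaximal.sum_second_le (hP : P.IsPivotal C K M) (hg : P.IsMaximal C g) {s k : ℕ}
    (hs : s ≤ P.m) (hk : g P.m + k ≤ 2 * P.m)
    (hcard : s ≤ k + ((Finset.range s).filter fun q => g (P.m + 1 + q) < M).card) :
    ∑ q ∈ Finset.range s, P.b (g (P.m + 1 + q))
      ≤ ((Finset.range s).filter fun q => g (P.m + 1 + q) < M).card * P.p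
        + ∑ q ∈ Finset.range k, P.b (endSecond K (g P.m) q) := by
  have hga := hg.feasible.arr
  rw [← Finset.sum_filter_add_sum_filter_not (Finset.range s) (fun q => g (P.m + 1 + q) < M)]
  have hc := Finset.card_filter_add_card_filter_not (s := Finset.range s)
    (fun q => g (P.m + 1 + q) < M)
  rw [Finset.card_range] at hc
  apply add_le_add
  · rw [← nsmul_eq_mul]
    apply Finset.sum_le_card_nsmul
    intro q hq
    simp only [Finset.mem_filter, Finset.mem_range] at hq
    exact (hga.b_second (by omega) (by omega)).2
  · have key := sum_b_le_sum_endSecond P (K := K) (t := g P.m) (k := k) hP.le hk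
      (((Finset.range s).filter fun q => ¬ g (P.m + 1 + q) < M).image fun q => g (P.m + 1 + q))
      (by
        intro a ha
        simp only [Finset.mem_image, Finset.mem_filter, Finset.mem_range] at ha
        obtain ⟨q, hq, rfl⟩ := ha
        exact ⟨hg.lt_second hP (by omega) (by omega) (by omega), hga.le _ (by omega) (by omega)⟩)
      (Finset.card_image_le.trans (by omega))
      (by
        rintro ⟨a, ha⟩
        simp only [Finset.mem_image, Finset.mem_filter, Finset.mem_range] at ha ⊢
        obtain ⟨q, hq, -⟩ := ha
        have h1 := hg.feasible.last_ge hP hg.time_eq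
        have := hP.lt
        exact ⟨g (P.m + 1), ⟨0, ⟨by omega, by simp; omega⟩, rfl⟩, h1⟩)
    rwa [Finset.sum_image] at key
    intro q hq q' hq' e
    simp only [Finset.coe_filter, Finset.mem_range, Set.mem_ofPred_eq] at hq hq'
    have := hga.inj _ _ (by omega) (by omega) (by omega) (by omega) e
    omega

theorem IsArrangement.card_le (hg : P.IsArrangement g) {a t : ℕ} (W : Finset ℕ)
    (hW : ∀ w ∈ W, 1 ≤ w ∧ w ≤ 2 * P.m ∧ a < g w ∧ g w ≤ t) : W.card ≤ t - a := by
  have := Finset.card_le_card_of_injOn (s := W) (t := Finset.Ioc a t) g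
    (by
      intro w hw
      have := hW w hw
      simp only [Finset.coe_Ioc, Set.mem_Ioc]
      omega)
    (by
      intro w hw w' hw' e
      have := hW w hw
      have := hW w' hw'
      exact hg.inj _ _ (by omega) (by omega) (by omega) (by omega) e)
  simpa using this

/-- An arrangement of maximal weight determines a feasible trim. -/
theorem IsMaximal.isFeasibleTrim (hP : P.IsPivotal C K M) (hg : P.IsMaximal C g) :
    P.IsFeasibleTrim C K M (g P.m) := by
  have hm := hP.m_pos
  have hga := hg.feasible.arr
  have hmt := hg.m_le hP
  have hMt := hg.le_last_first hP
  have hp := P.p_pos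
  refine ⟨hmt, hMt, hg.two_mul_le hP, fun e he => ?_⟩
  rcases Nat.lt_or_ge (g P.m) (M + e) with heM | heM
  swap
  · exact hP.trim_first heM he
  by_contra hcon
  push Not at hcon
  set t := g P.m with ht
  set τ := P.trimTime C K t (e + 1) with hτ
  have hFlt : ∀ j, 1 ≤ j → j ≤ t - e → P.F j < τ := fun j h1 h2 =>
    (P.F_mono j (t - e) h1 h2 (by omega)).trans_lt hcon
  -- The jobs up to `t - e` must start before `τ`, so none of them is in the `s = m - r₀` pairs
  -- starting at or after `τ`. The aim is to show that the pair `r₀ - 1` cannot start before `τ` in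
  -- spite of the choice of `r₀`.
  have hex : ∃ r, P.m ≤ r ∨ τ ≤ P.pairTime g r := ⟨P.m, Or.inl le_rfl⟩
  classical
  have hspec := Nat.find_spec hex
  have hmin := fun r (hr : r < Nat.find hex) => Nat.find_min hex hr
  have hle : Nat.find hex ≤ P.m := Nat.find_min' hex (Or.inl le_rfl)
  set r₀ := Nat.find hex with hr₀
  have hr0 : 0 < r₀ := by
    by_contra h0
    have h0 : r₀ = 0 := by omega
    rw [h0] at hspec
    rcases hspec with h | h
    · omega
    · have a := hg.feasible.first_pos (u := 1) le_rfl hm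
      have b := hg.first_add_le (e := P.m - 1) (by omega)
      rw [show P.m - (P.m - 1) = 1 by omega] at b
      have := hFlt (g 1) (hga.one_le 1 le_rfl (by omega)) (by omega)
      simp only [Nat.sub_self] at a
      linarith
  have hsuf : ∀ r, r₀ ≤ r → r < P.m → τ ≤ P.pairTime g r := by
    intro r h1 h2
    have := hga.pairTime_mono h1 h2.le
    rcases hspec with h | h
    · omega
    · linarith
  have hpre : P.pairTime g (r₀ - 1) < τ := by
    have := hmin (r₀ - 1) (by omega)
    push Not at this
    exact this.2
  obtain ⟨s, hs⟩ : ∃ s, s = P.m - r₀ := ⟨_, rfl⟩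
  have hfirst : ∀ q < s, t - e < g (P.m - q) := by
    intro q hq
    by_contra hc
    have a := hFlt _ (hga.one_le (P.m - q) (by omega) (by omega)) (not_lt.1 hc)
    have b := hg.feasible.first_pos (u := P.m - q) (by omega) (by omega)
    have c := hsuf (P.m - q - 1) (by omega) (by omega)
    linarith
  have hsecond : ∀ q < s, t - e < g (P.m + 1 + q) := by
    intro q hq
    by_contra hc
    have a := hFlt _ (hga.one_le (P.m + 1 + q) (by omega) (by omega)) (not_lt.1 hc)
    have b := hg.feasible.second_pos (u := P.m + 1 + q) (by omega) (by omega)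
    have c := hsuf (2 * P.m - (P.m + 1 + q)) (by omega) (by omega)
    linarith
  -- the jobs between `t - e` and `t` contained in a set of last pairs
  have hcount : ∀ B : Finset ℕ, (∀ q ∈ B, q < P.m ∧ t - e < g (P.m + 1 + q) ∧
      g (P.m + 1 + q) < M) → s + B.card ≤ e := by
    intro B hB
    have h1 := hga.card_le (a := t - e) (t := t)
      (Finset.Ioc (P.m - s) P.m ∪ B.image fun q => P.m + 1 + q) (by
        intro w hw
        simp only [Finset.mem_union, Finset.mem_Ioc, Finset.mem_image] at hw
        rcases hw with hw | ⟨q, hq, rfl⟩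
        · have a := hfirst (P.m - w) (by omega)
          rw [show P.m - (P.m - w) = w by omega] at a
          exact ⟨by omega, by omega, a, hg.first_le (by omega) (by omega)⟩
        · have := hB q hq
          exact ⟨by omega, by omega, by omega, by omega⟩)
    rw [Finset.card_union_of_disjoint, Finset.card_image_of_injective, Nat.card_Ioc] at h1
    · omega
    · intro q q' h
      simp only at h
      omega
    · rw [Finset.disjoint_left]
      intro w hw hw'
      simp only [Finset.mem_Ioc, Finset.mem_image] at hw hw'
      obtain ⟨q, -, rfl⟩ := hw'
      omega
  -- The first jobs of these `s` pairs and their second jobs below `M` are distinct elements of `(t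
  -- - e, t]`, hence `s + f ≤ e`. Each small second job costs at most `p`, while each pair saved
  -- gains `3 p`.
  have hsf := hcount ((Finset.range s).filter fun q => g (P.m + 1 + q) < M) (by
    intro q hq
    simp only [Finset.mem_filter, Finset.mem_range] at hq
    exact ⟨by omega, hsecond q hq.1, hq.2⟩)
  have hτ' : τ = C - 3 * P.p * (e + 1) - ∑ q ∈ Finset.range (e + 1), P.b (endSecond K t q) := by
    rw [hτ, trimTime_eq]; push_cast; ring
  have htime := pairTime_eq_sub (P := P) g (e := s + 1) (by omega)
  rw [hg.time_eq, Finset.sum_add_distrib, Finset.sum_const, Finset.card_range, nsmul_eq_mul,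
    show P.m - (s + 1) = r₀ - 1 by omega] at htime
  have hsum := hg.sum_second_le hP (s := s + 1) (k := e + 1) (by omega) (by omega)
    (by omega)
  rw [← ht] at hsum
  set f := ((Finset.range s).filter fun q => g (P.m + 1 + q) < M).card with hf
  by_cases hy : g (P.m + 1 + s) < M
  · rw [Finset.range_add_one, Finset.filter_insert, if_pos hy,
      Finset.card_insert_of_notMem (by simp), ← hf, ← Finset.range_add_one] at hsum
    push_cast at hsum htime
    -- The only case without slack. Here `(t - e, t]` is exhausted by first jobs, so the small
    -- second job of the pair `r₀ - 1` is at most `t - e`; it starts `p` after its pair, which makes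
    -- up for the missing `p`.
    by_cases hfs : f = 0 ∧ s = e
    · have hyle : g (P.m + 1 + s) ≤ t - e := by
        by_contra hc
        have := hcount {s} (by
          intro q hq
          simp only [Finset.mem_singleton] at hq
          subst hq
          exact ⟨by omega, by omega, hy⟩)
        simp at this
        omega
      have a := hFlt _ (hga.one_le (P.m + 1 + s) (by omega) (by omega)) hyle
      have b := hg.feasible.second_pos (u := P.m + 1 + s) (by omega) (by omega)
      rw [show 2 * P.m - (P.m + 1 + s) = r₀ - 1 by omega] at b
      rw [hfs.1, hfs.2] at hsum
      rw [hfs.2] at htime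
      push_cast at hsum
      linarith
    · have h3 : 3 * s + f + 1 ≤ 3 * e := by omega
      have h4 : (3 * s + f + 1 : ℝ) ≤ 3 * e := by exact_mod_cast h3
      nlinarith
  · rw [Finset.range_add_one, Finset.filter_insert, if_neg hy, ← hf,
      ← Finset.range_add_one] at hsum
    push_cast at htime
    have h3 : 3 * s + f ≤ 3 * e := by omega
    have h4 : (3 * s + f : ℝ) ≤ 3 * e := by exact_mod_cast h3
    nlinarith

end PairProblem

/-! ### Minimality of `t`: a smaller feasible trim would allow a larger weight. -/

namespace PairProblem
variable {P : PairProblem} {g g' h : ℕ → ℕ} {C : ℝ} {K M : ℕ}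

/-- The cyclic relabelling of the jobs `v, v + 1, …, t` which sends `v` to `t`. -/
def shiftJobs (v t j : ℕ) : ℕ := if j = v then t else if v < j ∧ j ≤ t then j - 1 else j

theorem shiftJobs_bounds {v t j n : ℕ} (hv : 1 ≤ v) (ht : t ≤ n) (h1 : 1 ≤ j)
    (h2 : j ≤ n) (hvt : v ≤ t) : 1 ≤ shiftJobs v t j ∧ shiftJobs v t j ≤ n := by
  unfold shiftJobs; split_ifs <;> omega

theorem shiftJobs_inj {v t i j : ℕ} (hvt : v ≤ t) (h : shiftJobs v t i = shiftJobs v t j) :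
    i = j := by
  unfold shiftJobs at h; split_ifs at h <;> omega

/-- If a trim with first jobs up to `t - 1` is feasible, then the weight of an arrangement with
first jobs up to `t` can be increased. -/
theorem IsMaximal.not_isFeasibleTrim_pred (hP : P.IsPivotal C K M) (hg : P.IsMaximal C g) {t : ℕ}
    (ht : g P.m = t + 1) : ¬ P.IsFeasibleTrim C K M t := by
  intro htrim
  have hm := hP.m_pos
  have hga := hg.feasible.arr
  have hmt := htrim.m_le
  have hMt := htrim.M_le
  have hKM := hP.lt
  have hM1 := hP.one_le
  have htn := hga.le P.m (by omega) (by omega)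
  have hsec : ∀ w, P.m < w → w ≤ 2 * P.m → M ≤ g w → t + 1 < g w := fun w h1 h2 h3 => by
    have := hg.lt_second hP h1 h2 h3
    omega
  -- The largest second job `v` below `M`. It exists, since otherwise all `m` second jobs would
  -- exceed `t + 1`, contradicting `m ≤ t`.
  obtain ⟨wv, hwv, hmax⟩ : ∃ wv ∈ (Finset.Ioc P.m (2 * P.m)).filter (fun w => g w < M),
      ∀ w ∈ (Finset.Ioc P.m (2 * P.m)).filter (fun w => g w < M), g w ≤ g wv := by
    apply Finset.exists_max_image
    by_contra hne
    rw [Finset.not_nonempty_iff_eq_empty, Finset.filter_eq_empty_iff] at hne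
    have := hga.count_second (t := t + 1) (e := P.m - 1) (by omega) fun q hq => by
      apply hsec _ (by omega) (by omega)
      have := hne (x := P.m + 1 + q) (by simp; omega)
      omega
    omega
  simp only [Finset.mem_filter, Finset.mem_Ioc] at hwv hmax
  set v := g wv with hv
  have hv1 : 1 ≤ v := hga.one_le wv (by omega) (by omega)
  -- all jobs from `v + 1` to `t + 1` are first jobs
  have hfirst : ∀ j, v < j → j ≤ g P.m → ∃ w, 1 ≤ w ∧ w ≤ P.m ∧ g w = j := by
    intro j h1 h2
    obtain ⟨w, hw1, hw2, hw⟩ := hga.surj (j := j) (by omega) (by omega)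
    refine ⟨w, hw1, ?_, hw⟩
    by_contra hcon
    rcases Nat.lt_or_ge j M with h | h
    · have := hmax w ⟨⟨by omega, hw2⟩, by omega⟩
      omega
    · have := hsec w (by omega) hw2 (by omega)
      omega
  have hneq : ∀ w, 1 ≤ w → w ≤ 2 * P.m → g w = v → w = wv := fun w h1 h2 h3 =>
    hga.inj _ _ h1 h2 (by omega) (by omega) (h3.trans hv)
  have hsecond : ∀ w, P.m < w → w ≤ 2 * P.m → g w = v ∨ g w < v ∨ t + 1 < g w := by
    intro w h1 h2
    rcases Nat.lt_or_ge (g w) M with h | h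
    · have := hmax w ⟨⟨h1, h2⟩, h⟩
      omega
    · have := hsec w h1 h2 h
      omega
  -- The second job `v` is replaced by `t + 1`, and the first jobs `v + 1, …, t + 1` are lowered by
  -- one. No second job decreases and no first job increases, so no pair is delayed and the weight
  -- grows.
  set g₁ : ℕ → ℕ := fun w => shiftJobs v (t + 1) (g w) with hg₁
  have harr : P.IsArrangement g₁ :=
    ⟨fun w h1 h2 => (shiftJobs_bounds hv1 (ht ▸ htn) (hga.one_le w h1 h2) (hga.le w h1 h2)
        (by omega)).1,
      fun w h1 h2 => (shiftJobs_bounds hv1 (ht ▸ htn) (hga.one_le w h1 h2) (hga.le w h1 h2)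
        (by omega)).2,
      fun u w h1 h2 h3 h4 e => hga.inj u w h1 h2 h3 h4 (shiftJobs_inj (by omega) e)⟩
  have hge : ∀ w, P.m < w → w ≤ 2 * P.m → g w ≤ g₁ w := by
    intro w h1 h2
    have := hsecond w h1 h2
    simp only [hg₁, shiftJobs]
    split_ifs <;> omega
  have hle : ∀ w, 1 ≤ w → w ≤ P.m → g₁ w ≤ g w := by
    intro w h1 h2
    have h3 : g w ≠ v := fun e => by
      have := hneq w h1 (by omega) e
      omega
    simp only [hg₁, shiftJobs]
    split_ifs <;> omega
  have htime : ∀ r ≤ P.m, P.pairTime g₁ r ≤ P.pairTime g r :=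
    fun r hr => pairTime_le_of_le hga harr hge hr
  have hC₁ : P.pairTime g₁ P.m ≤ C := (htime _ le_rfl).trans hg.time_eq.le
  have hself : P.IsResorting K M g₁ g₁ := by
    refine ⟨harr, fun _ _ _ => rfl, fun _ _ _ _ => rfl, fun u h1 h2 => ?_, fun _ _ => le_rfl, ?_⟩
    · have a := hg.feasible.second_pos h1 h2
      have b := htime (2 * P.m - u) (by omega)
      have c := P.F_mono _ _ (hga.one_le u (by omega) h2) (hge u h1 h2)
        (harr.le u (by omega) h2)
      linarith
    · exact (hg.feasible.last_ge hP hg.time_eq).trans (hge _ (by omega) (by omega))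
  -- The relabelling may leave the second jobs unsorted and first jobs late. Sorting the second jobs
  -- from `M` on makes the last ones equal to those of the trim for `t`.
  obtain ⟨h, hh, hhmax⟩ := exists_max_weight (P := P) (fun h => P.IsResorting K M g₁ h)
    (fun _ h => h.arr) ⟨g₁, hself⟩
  have hsort := hh.isSorted hP hC₁ hhmax
  have hCh : P.pairTime h P.m ≤ C := (hh.time_le _ le_rfl).trans hC₁
  have hw1 : P.weight g < P.weight g₁ := by
    apply weight_lt hga harr P.m
    · intro w h1 h2
      rcases Nat.lt_or_ge P.m w with h | h
      · have := hge w h h2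
        exact mul_nonneg (by omega) (by omega)
      · have := hle w h1 h
        exact mul_nonneg_of_nonpos_of_nonpos (by omega) (by omega)
    · refine ⟨wv, by omega, by omega, mul_pos (by omega) ?_⟩
      have : g₁ wv = t + 1 := by simp [hg₁, shiftJobs, ← hv]
      omega
  have hw2 := hhmax _ hself
  have hY : ∀ w, P.m < w → w ≤ 2 * P.m → M ≤ h w → t < h w := by
    intro w h1 h2 h3
    by_contra hcon
    obtain ⟨x, hx1, hx2, hx⟩ := hfirst (h w + 1) (by omega) (by omega)
    have e1 : g₁ x = h w := by
      simp only [hg₁, shiftJobs, hx]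
      split_ifs <;> omega
    rw [← hh.first_eq x hx1 hx2] at e1
    have := hh.arr.inj x w hx1 (by omega) (by omega) h2 e1
    omega
  have hX : ∀ w, 1 ≤ w → w ≤ P.m → M ≤ h w → h w ≤ t := by
    intro w h1 h2 h3
    rw [hh.first_eq w h1 h2] at h3 ⊢
    have := hg.first_le h1 h2
    have h4 : g w ≠ v := fun e => by
      have := hneq w h1 (by omega) e
      omega
    simp only [hg₁, shiftJobs] at h3 ⊢
    split_ifs at h3 ⊢ <;> omega
  have hbig : ∀ w, P.m < w → w ≤ 2 * P.m → M ≤ g₁ w → M ≤ h w := by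
    intro w h1 h2 h3
    by_contra hcon
    obtain ⟨x, hx1, hx2, hx⟩ := harr.surj (hh.arr.one_le w (by omega) h2) (hh.arr.le w (by omega) h2)
    have e : h x = g₁ x := by
      rcases Nat.lt_or_ge P.m x with hxm | hxm
      · exact hh.small_eq x hxm hx2 (by omega)
      · exact hh.first_eq x hx1 hxm
    have := hh.arr.inj x w hx1 hx2 (by omega) h2 (e.trans hx)
    subst this
    omega
  have hf : P.IsFeasible h := by
    refine isFeasible_of_pos hh.arr (fun u h1 h2 => ?_) hh.second
    have hne : g u ≠ v := fun e => by
      have := hneq u h1 (by omega) e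
      omega
    have a := htime (u - 1) (by omega)
    have b := hh.time_le (u - 1) (by omega)
    have c := hg.feasible.first_pos h1 h2
    have d := hg.first_le h1 h2
    rw [hh.first_eq u h1 h2]
    rcases Nat.lt_or_ge (g u) v with hlt | hlt
    · have : g₁ u = g u := by
        simp only [hg₁, shiftJobs]
        split_ifs <;> omega
      rw [this]
      linarith
    -- A lowered first job `t - e` is in the `e`-th pair from the end. From there on all second jobs
    -- are those of the trim, so feasibility of the trim shows that it is on time.
    obtain ⟨e, he⟩ : ∃ e, e = t + 1 - g u := ⟨_, rfl⟩
    obtain ⟨hem, heq⟩ := hg.first_eq hfirst (e := e) (by omega)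
    have hu : u = P.m - e := hga.inj _ _ h1 (by omega) (by omega) (by omega) (by omega)
    have hall : ∀ q ≤ e, t + 1 < g (P.m + 1 + q) := by
      intro q hq
      obtain ⟨hqm, hqe⟩ := hg.first_eq hfirst (e := q) (by omega)
      have a := hg.first_lt_second (u := P.m - q) (w := P.m + 1 + q) (by omega) (by omega)
        (by omega) (by omega)
      have b := hsecond (P.m + 1 + q) (by omega) (by omega)
      omega
    have hcount := hga.count_second hem hall
    have hval : ∀ q ≤ e, h (P.m + 1 + q) = endSecond K t q := by
      intro q hq
      refine hsort.eq_endSecond hP hY hX hMt (by omega) fun q' hq' => ?_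
      have := hall q' (by omega)
      have := hge (P.m + 1 + q') (by omega) (by omega)
      exact hbig _ (by omega) (by omega) (by omega)
    have hsum := pairTime_eq_sub (P := P) h (e := e + 1) (by omega)
    rw [Finset.sum_congr rfl (fun q hq => by
      rw [hval q (by simp only [Finset.mem_range] at hq; omega)])] at hsum
    have key := htrim.first e (by omega)
    have hg₁u : g₁ u = t - e := by
      simp only [hg₁, shiftJobs]
      split_ifs <;> omega
    rw [hg₁u, show u - 1 = P.m - (e + 1) by omega, hsum]
    unfold trimTime at key
    linarith
  have := hg.max h hf hCh
  omega

theorem IsMaximal.le_of_isFeasibleTrim (hP : P.IsPivotal C K M) (hg : P.IsMaximal C g) {t : ℕ}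
    (ht : P.IsFeasibleTrim C K M t) : g P.m ≤ t := by
  by_contra hcon
  have := hg.two_mul_le hP
  exact hg.not_isFeasibleTrim_pred hP (t := g P.m - 1) (by omega)
    (ht.of_le hP (by omega) (by omega))

/-- If the jobs can be processed until `C`, then they can be arranged such that the last pairs are
those of the optimal trim. -/
theorem IsPivotal.exists_arrangement (hP : P.IsPivotal C K M)
    (hex : ∃ g, P.IsFeasible g ∧ P.pairTime g P.m ≤ C) :
    ∃ g t, P.IsFeasible g ∧ P.pairTime g P.m = C ∧ P.IsFeasibleTrim C K M t ∧
      (∀ t', P.IsFeasibleTrim C K M t' → t ≤ t') ∧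
      ∀ e, M + e ≤ t → e < P.m ∧ g (P.m - e) = t - e ∧ g (P.m + 1 + e) = endSecond K t e := by
  obtain ⟨g, hg⟩ := exists_isMaximal hP hex
  refine ⟨g, g P.m, hg.feasible, hg.time_eq, hg.isFeasibleTrim hP,
    fun t' ht' => hg.le_of_isFeasibleTrim hP ht', fun e he => ?_⟩
  obtain ⟨h1, h2⟩ := hg.first_eq_of_le hP he
  refine ⟨h1, h2, ?_⟩
  refine (hg.isSorted hP).eq_endSecond hP (fun w a b c => hg.lt_second hP a b c)
    (fun w a b _ => hg.first_le a b) (hg.le_last_first hP) h1 fun q hq => ?_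
  exact (hg.second_ge hP (by omega)).2

end PairProblem

/-! ### From schedules to arrangements and back. -/

namespace CoupledInstance

/-- The arrangement problem of an instance with `2 m` jobs and maximum lateness `L`. -/
def pairProblem (I : CoupledInstance) (hI : I.IsDisagreeableNoLong) (L : ℝ) (m : ℕ)
    (hm : I.n = 2 * m) : PairProblem where
  m := m
  p := I.p
  b := I.b
  F := fun j => I.d j + L - I.b j - 2 * I.p
  p_pos := hI.p_pos
  b_nonneg := fun j h1 h2 => hI.b_nonneg j (by simp [jobs]; omega)
  b_le := fun j h1 h2 => hI.b_le_p j (by simp [jobs]; omega)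
  b_anti := fun i j h1 h2 h3 => hI.lpt i (by simp [jobs]; omega) j (by simp [jobs]; omega) h2
  -- The disagreeable order makes `d j - b j` nondecreasing.
  F_mono := fun i j h1 h2 h3 => by
    have a := hI.lpt i (by simp [jobs]; omega) j (by simp [jobs]; omega) h2
    have b := hI.edd i (by simp [jobs]; omega) j (by simp [jobs]; omega) h2
    linarith

variable {I : CoupledInstance} {s : ℕ → ℝ}

theorem IsSchedule.add_p_le (hs : I.IsSchedule s) (hp : 0 < I.p) {i j : ℕ} (hi : i ∈ I.jobs)
    (hj : j ∈ I.jobs) (hij : i ≠ j) (h : s i ≤ s j) : s i + I.p ≤ s j := by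
  rcases hs.first_first i hi j hj hij with h1 | h1 <;> linarith

/-- The first task of `j` lies either in the delay of `i`, which it fills completely, or after the
second task of `i`. -/
theorem IsSchedule.interlaced_or (hs : I.IsSchedule s) (hp : 0 < I.p) {i j : ℕ} (hi : i ∈ I.jobs)
    (hj : j ∈ I.jobs) (hij : i ≠ j) (h : s i ≤ s j) :
    s j = s i + I.p ∨ s i + 2 * I.p + I.b i ≤ s j := by
  have a := hs.add_p_le hp hi hj hij h
  rcases hs.first_second j hj i hi hij.symm with h1 | h1
  · left; linarith
  · right; linarith

/-- The jobs in the order of their start times. -/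
theorem exists_sorted_jobs (s : ℕ → ℝ) (n : ℕ) : ∃ z : ℕ → ℕ,
    (∀ r < n, 1 ≤ z r ∧ z r ≤ n) ∧ (∀ r r', r < n → r' < n → z r = z r' → r = r') ∧
    ∀ r r', r ≤ r' → r' < n → s (z r) ≤ s (z r') := by
  let f : Fin n → ℝ := fun i => s (i + 1)
  refine ⟨fun r => if h : r < n then (Tuple.sort f ⟨r, h⟩ : ℕ) + 1 else 0, ?_, ?_, ?_⟩
  · intro r hr
    simp only [hr, dif_pos]
    have := (Tuple.sort f ⟨r, hr⟩).isLt
    omega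
  · intro r r' hr hr' h
    simp only [hr, hr', dif_pos, Nat.add_right_cancel_iff] at h
    have := (Tuple.sort f).injective (Fin.ext h)
    simpa using this
  · intro r r' h hr'
    have hr : r < n := by omega
    simp only [hr, hr', dif_pos]
    exact Tuple.monotone_sort f (show (⟨r, hr⟩ : Fin n) ≤ ⟨r', hr'⟩ from h)

/-- Every schedule can be turned into an arrangement in pairs which is not longer. -/
theorem IsSchedule.exists_arrangement (hI : I.IsDisagreeableNoLong) (hs : I.IsSchedule s)
    {L C : ℝ} (hL : I.MaxLatenessLE s L) (hC : ∀ j ∈ I.jobs, I.completion s j ≤ C) {m : ℕ}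
    (hm : I.n = 2 * m) (hm0 : 0 < m) :
    ∃ g, (I.pairProblem hI L m hm).IsFeasible g ∧ (I.pairProblem hI L m hm).pairTime g m ≤ C := by
  set P := I.pairProblem hI L m hm with hP
  have hPm : P.m = m := rfl
  have hp := hI.p_pos
  obtain ⟨z, hz, hinj, hmono⟩ := exists_sorted_jobs s (2 * m)
  have hjob : ∀ r < 2 * m, z r ∈ I.jobs := fun r hr => by
    have := hz r hr
    simp only [jobs, Finset.mem_Icc]
    omega
  have hne : ∀ r r', r < r' → r' < 2 * m → z r ≠ z r' := fun r r' h h' e => by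
    have := hinj r r' (by omega) h' e
    omega
  have hlate : ∀ j ∈ I.jobs, s j ≤ P.F j := fun j hj => by
    have h := hL j hj
    simp only [completion] at h
    show s j ≤ I.d j + L - I.b j - 2 * I.p
    linarith
  -- Consecutive jobs form a pair; the larger number, which has the shorter second task and the
  -- larger bound `F`, becomes the second job.
  set g : ℕ → ℕ := fun w => if w ≤ m then min (z (2 * (w - 1))) (z (2 * (w - 1) + 1))
    else max (z (2 * (2 * m - w))) (z (2 * (2 * m - w) + 1)) with hg
  have g1 : ∀ r < m, g (r + 1) = min (z (2 * r)) (z (2 * r + 1)) := fun r hr => by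
    simp only [hg]
    rw [if_pos (by omega), Nat.add_sub_cancel]
  have g2 : ∀ r < m, g (2 * m - r) = max (z (2 * r)) (z (2 * r + 1)) := fun r hr => by
    simp only [hg]
    rw [if_neg (by omega), show 2 * m - (2 * m - r) = r by omega]
  have hpos : ∀ w, 1 ≤ w → w ≤ 2 * m → ∃ r < m,
      (w = r + 1 ∧ g w = min (z (2 * r)) (z (2 * r + 1))) ∨
      (w = 2 * m - r ∧ g w = max (z (2 * r)) (z (2 * r + 1))) := by
    intro w h1 h2
    rcases Nat.lt_or_ge m w with h | h
    · refine ⟨2 * m - w, by omega, Or.inr ⟨by omega, ?_⟩⟩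
      rw [← g2 _ (by omega)]
      congr 1
      omega
    · refine ⟨w - 1, by omega, Or.inl ⟨by omega, ?_⟩⟩
      rw [← g1 _ (by omega)]
      congr 1
      omega
  have harr : P.IsArrangement g := by
    refine ⟨fun w h1 h2 => ?_, fun w h1 h2 => ?_, fun u w h1 h2 h3 h4 e => ?_⟩
    · obtain ⟨r, hr, h⟩ := hpos w h1 h2
      have a := hz (2 * r) (by omega)
      have b := hz (2 * r + 1) (by omega)
      omega
    · obtain ⟨r, hr, h⟩ := hpos w h1 h2
      have a := hz (2 * r) (by omega)
      have b := hz (2 * r + 1) (by omega)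
      omega
    · obtain ⟨r, hr, h⟩ := hpos u h1 h2
      obtain ⟨r', hr', h'⟩ := hpos w h3 h4
      have a1 := hinj (2 * r) (2 * r') (by omega) (by omega)
      have a2 := hinj (2 * r) (2 * r' + 1) (by omega) (by omega)
      have a3 := hinj (2 * r + 1) (2 * r') (by omega) (by omega)
      have a4 := hinj (2 * r + 1) (2 * r' + 1) (by omega) (by omega)
      have a5 := hne (2 * r) (2 * r + 1) (by omega) (by omega)
      have a6 := hne (2 * r') (2 * r' + 1) (by omega) (by omega)
      by_cases hrr : r = r'
      · subst hrr
        omega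
      rcases h with ⟨h, h1⟩ | ⟨h, h1⟩ <;> rcases h' with ⟨h', h1'⟩ | ⟨h', h1'⟩ <;>
        rw [h1, h1'] at e <;> omega
  have hbmax : ∀ r < m, I.b (g (2 * m - r)) ≤ I.b (z (2 * r)) ∧
      I.b (g (2 * m - r)) ≤ I.b (z (2 * r + 1)) := by
    intro r hr
    have a := hz (2 * r) (by omega)
    have b := hz (2 * r + 1) (by omega)
    have c := g2 r hr
    exact ⟨P.b_anti _ _ a.1 (by omega) (by omega), P.b_anti _ _ b.1 (by omega) (by omega)⟩
  have hsucc : ∀ r < m, P.pairTime g (r + 1)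
      = P.pairTime g r + (3 * I.p + I.b (g (2 * m - r))) := fun r _ => PairProblem.pairTime_succ r
  -- Of three consecutive jobs at most one neighbouring pair is interlaced, by `no_chain`. So the
  -- third starts at least `3 p` and one second task after the first, and that task is not shorter
  -- than the one chosen for the pair.
  have htime : ∀ r < m, P.pairTime g r ≤ s (z (2 * r)) := by
    intro r
    induction r with
    | zero =>
      intro _
      simp only [PairProblem.pairTime, Finset.range_zero, Finset.sum_empty]
      exact hs.start_nonneg _ (hjob _ (by omega))
    | succ r ih =>
      intro hr
      have a := ih (by omega)
      have b := hbmax r (by omega)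
      rw [hsucc r (by omega), show 2 * (r + 1) = 2 * r + 2 by ring]
      rcases hs.interlaced_or hp (hjob (2 * r) (by omega)) (hjob (2 * r + 1) (by omega))
        (hne _ _ (by omega) (by omega)) (hmono _ _ (by omega) (by omega)) with h1 | h1
      · rcases hs.interlaced_or hp (hjob (2 * r + 1) (by omega)) (hjob (2 * r + 2) (by omega))
          (hne _ _ (by omega) (by omega)) (hmono _ _ (by omega) (by omega)) with h2 | h2
        · exact absurd ⟨h1, h2⟩ (hs.no_chain _ (hjob (2 * r) (by omega)) _
            (hjob (2 * r + 1) (by omega)) _ (hjob (2 * r + 2) (by omega)))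
        · linarith
      · have h2 := hs.add_p_le hp (hjob (2 * r + 1) (by omega)) (hjob (2 * r + 2) (by omega))
          (hne _ _ (by omega) (by omega)) (hmono _ _ (by omega) (by omega))
        linarith
  refine ⟨g, ⟨harr, fun r hr => ?_, fun r hr => ?_⟩, ?_⟩
  · have a := htime r hr
    have b := hlate _ (hjob (2 * r) (by have : r < m := hr; omega))
    have c := hlate _ (hjob (2 * r + 1) (by have : r < m := hr; omega))
    have d := hmono (2 * r) (2 * r + 1) (by omega) (by have : r < m := hr; omega)
    rw [g1 r hr]
    rcases min_choice (z (2 * r)) (z (2 * r + 1)) with e | e <;> rw [e] <;> linarith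
  · have hr' : r < m := hr
    have a := htime r hr
    have c := hlate _ (hjob (2 * r + 1) (by omega))
    have d := hs.add_p_le hp (hjob (2 * r) (by omega)) (hjob (2 * r + 1) (by omega))
          (hne _ _ (by omega) (by omega)) (hmono _ _ (by omega) (by omega))
    have e := hz (2 * r) (by omega)
    have f := hz (2 * r + 1) (by omega)
    have := P.F_mono (z (2 * r + 1)) (max (z (2 * r)) (z (2 * r + 1))) f.1 (le_max_right _ _)
      (by rw [hPm]; omega)
    have e' := g2 r hr'
    show P.pairTime g r + I.p ≤ P.F (g (2 * m - r))
    rw [e']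
    linarith
  · obtain ⟨r, rfl⟩ : ∃ r, m = r + 1 := ⟨m - 1, by omega⟩
    rw [hsucc r (by omega)]
    have a := htime r (by omega)
    have b := hbmax r (by omega)
    have c := hC _ (hjob (2 * r + 1) (by omega))
    have d := hI.b_nonneg _ (hjob (2 * r + 1) (by omega))
    simp only [completion] at c
    rcases hs.interlaced_or hp (hjob (2 * r) (by omega)) (hjob (2 * r + 1) (by omega))
        (hne _ _ (by omega) (by omega)) (hmono _ _ (by omega) (by omega)) with h1 | h1 <;> linarith

/-- `s` processes the pairs of the arrangement `g` without idle time from `0` on. -/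
def Follows (P : PairProblem) (g : ℕ → ℕ) (s : ℕ → ℝ) : Prop :=
  (∀ r < P.m, s (g (r + 1)) = P.pairTime g r) ∧
    ∀ r < P.m, s (g (2 * P.m - r)) = P.pairTime g r + P.p

theorem exists_follows {P : PairProblem} {g : ℕ → ℕ} (hg : P.IsArrangement g) :
    ∃ s, Follows P g s := by
  classical
  let start : ℕ → ℝ := fun w =>
    if w ≤ P.m then P.pairTime g (w - 1) else P.pairTime g (2 * P.m - w) + P.p
  let s : ℕ → ℝ := fun j =>
    if h : ∃ w, 1 ≤ w ∧ w ≤ 2 * P.m ∧ g w = j then start h.choose else 0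
  have key : ∀ w, 1 ≤ w → w ≤ 2 * P.m → s (g w) = start w := by
    intro w h1 h2
    have h : ∃ v, 1 ≤ v ∧ v ≤ 2 * P.m ∧ g v = g w := ⟨w, h1, h2, rfl⟩
    obtain ⟨a, b, c⟩ := h.choose_spec
    simp only [s, dif_pos h]
    rw [hg.inj _ _ a b h1 h2 c]
  refine ⟨s, fun r hr => ?_, fun r hr => ?_⟩
  · rw [key _ (by omega) (by omega)]
    simp only [start]
    rw [if_pos (by omega), Nat.add_sub_cancel]
  · rw [key _ (by omega) (by omega)]
    simp only [start]
    rw [if_neg (by omega), show 2 * P.m - (2 * P.m - r) = r by omega]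

section Follows
variable {hI : I.IsDisagreeableNoLong} {L : ℝ} {m : ℕ} {hm : I.n = 2 * m} {g : ℕ → ℕ}

/-- As `b j ≤ p`, each job stays within the time slot of its pair. All machine conditions then
reduce to comparing slots, or the two jobs of one slot. -/
theorem Follows.job (hs : Follows (I.pairProblem hI L m hm) g s)
    (hg : (I.pairProblem hI L m hm).IsArrangement g) {j : ℕ} (hj : j ∈ I.jobs) :
    ∃ r < m, (j = g (r + 1) ∧ s j = (I.pairProblem hI L m hm).pairTime g r ∨
      j = g (2 * m - r) ∧ s j = (I.pairProblem hI L m hm).pairTime g r + I.p) ∧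
      I.completion s j ≤ (I.pairProblem hI L m hm).pairTime g (r + 1) ∧
      (I.pairProblem hI L m hm).pairTime g (r + 1) = (I.pairProblem hI L m hm).pairTime g r
        + (3 * I.p + I.b (g (2 * m - r))) ∧ 0 ≤ I.b (g (2 * m - r)) ∧
      0 ≤ I.b j ∧ I.b j ≤ I.p := by
  have hj' := hj
  simp only [jobs, Finset.mem_Icc] at hj'
  have hb := hI.b_le_p j hj
  have hb0 := hI.b_nonneg j hj
  obtain ⟨w, h1, h2, rfl⟩ := hg.surj (j := j) hj'.1 (hm ▸ hj'.2)
  have h2' : w ≤ 2 * m := h2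
  rcases Nat.lt_or_ge m w with h | h
  · have hr : 2 * m - w < m := by omega
    have e := hs.2 (2 * m - w) hr
    have f : (I.pairProblem hI L m hm).pairTime g (2 * m - w + 1) = _ :=
      PairProblem.pairTime_succ _
    have e0 : 2 * m - (2 * m - w) = w := by omega
    change s (g (2 * m - (2 * m - w))) = _ + I.p at e
    change _ = _ + (3 * I.p + I.b (g (2 * m - (2 * m - w)))) at f
    rw [e0] at e f
    refine ⟨2 * m - w, hr, Or.inr ⟨by rw [e0], e⟩, ?_, by rw [e0]; exact f, by rw [e0]; exact hb0,
      hb0, hb⟩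
    simp only [completion]
    linarith
  · have hr : w - 1 < m := by omega
    have e := hs.1 (w - 1) hr
    have e0 : w - 1 + 1 = w := by omega
    rw [e0] at e
    have f : (I.pairProblem hI L m hm).pairTime g (w - 1 + 1) = _ :=
      PairProblem.pairTime_succ _
    change _ = _ + (3 * I.p + I.b (g (2 * m - (w - 1)))) at f
    have hb' := (hg.b_second (w := 2 * m - (w - 1)) (by omega) (Nat.sub_le _ _)).1
    change 0 ≤ I.b (g (2 * m - (w - 1))) at hb'
    refine ⟨w - 1, hr, Or.inl ⟨by rw [e0], e⟩, ?_, f, hb', hb0, hb⟩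
    simp only [completion]
    linarith

theorem Follows.isSchedule (hs : Follows (I.pairProblem hI L m hm) g s)
    (hg : (I.pairProblem hI L m hm).IsArrangement g) : I.IsSchedule s := by
  have hp := hI.p_pos
  have hmono : ∀ r r', r < r' → r' < m → (I.pairProblem hI L m hm).pairTime g (r + 1)
      ≤ (I.pairProblem hI L m hm).pairTime g r' := fun r r' h h' =>
    hg.pairTime_mono h (le_of_lt (show r' < m from h'))
  have h0 : ∀ r < m, 0 ≤ (I.pairProblem hI L m hm).pairTime g r := fun r h => by
    have := hg.pairTime_mono (r := 0) (s := r) (by omega) (le_of_lt (show r < m from h))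
    simpa [PairProblem.pairTime] using this
  constructor
  · intro j hj
    obtain ⟨r, hr, h1, -⟩ := hs.job hg hj
    have := h0 r hr
    rcases h1 with ⟨_, h⟩ | ⟨_, h⟩ <;> linarith
  · intro i hi j hj hij
    obtain ⟨r, hr, h1, h2, h3, h4, h5, h6⟩ := hs.job hg hi
    obtain ⟨r', hr', h1', h2', h3', h4', h5', h6'⟩ := hs.job hg hj
    simp only [completion] at h2 h2'
    rcases lt_trichotomy r r' with h | h | h
    · have := hmono r r' h hr'
      left
      rcases h1' with ⟨_, h⟩ | ⟨_, h⟩ <;> linarith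
    · subst h
      rcases h1 with ⟨e, h⟩ | ⟨e, h⟩ <;> rcases h1' with ⟨e', h'⟩ | ⟨e', h'⟩
      · exact absurd (e.trans e'.symm) hij
      · left; linarith
      · right; linarith
      · exact absurd (e.trans e'.symm) hij
    · have := hmono r' r h hr
      right
      rcases h1 with ⟨_, h⟩ | ⟨_, h⟩ <;> linarith
  · intro i hi j hj hij
    obtain ⟨r, hr, h1, h2, h3, h4, h5, h6⟩ := hs.job hg hi
    obtain ⟨r', hr', h1', h2', h3', h4', h5', h6'⟩ := hs.job hg hj
    simp only [completion] at h2 h2'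
    rcases lt_trichotomy r r' with h | h | h
    · have := hmono r r' h hr'
      left
      rcases h1' with ⟨_, h⟩ | ⟨_, h⟩ <;> linarith
    · subst h
      rcases h1 with ⟨e, h⟩ | ⟨e, h⟩ <;> rcases h1' with ⟨e', h'⟩ | ⟨e', h'⟩
      · exact absurd (e.trans e'.symm) hij
      · left; linarith
      · left; linarith
      · exact absurd (e.trans e'.symm) hij
    · have := hmono r' r h hr
      right
      rcases h1 with ⟨_, h⟩ | ⟨_, h⟩ <;> linarith
  · intro i hi j hj hij
    obtain ⟨r, hr, h1, h2, h3, h4, h5, h6⟩ := hs.job hg hi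
    obtain ⟨r', hr', h1', h2', h3', h4', h5', h6'⟩ := hs.job hg hj
    simp only [completion] at h2 h2'
    rcases lt_trichotomy r r' with h | h | h
    · have := hmono r r' h hr'
      left
      rcases h1' with ⟨_, h⟩ | ⟨_, h⟩ <;> linarith
    · subst h
      rcases h1 with ⟨e, h⟩ | ⟨e, h⟩ <;> rcases h1' with ⟨e', h'⟩ | ⟨e', h'⟩
      · exact absurd (e.trans e'.symm) hij
      · left; linarith
      · right; linarith
      · exact absurd (e.trans e'.symm) hij
    · have := hmono r' r h hr
      right
      rcases h1 with ⟨_, h⟩ | ⟨_, h⟩ <;> linarith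
  · rintro i hi j hj k hk ⟨e1, e2⟩
    have key : ∀ i ∈ I.jobs, ∀ j ∈ I.jobs, s j = s i + I.p → ∃ r < m,
        s i = (I.pairProblem hI L m hm).pairTime g r ∧
        s j = (I.pairProblem hI L m hm).pairTime g r + I.p := by
      intro i hi j hj e
      obtain ⟨r, hr, h1, h2, h3, h4, h5, h6⟩ := hs.job hg hi
      obtain ⟨r', hr', h1', h2', h3', h4', h5', h6'⟩ := hs.job hg hj
      refine ⟨r, hr, ?_⟩
      rcases lt_trichotomy r r' with h | h | h
      · have := hmono r r' h hr'
        exfalso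
        rcases h1 with ⟨_, h⟩ | ⟨_, h⟩ <;> rcases h1' with ⟨_, h'⟩ | ⟨_, h'⟩ <;> linarith
      · subst h
        rcases h1 with ⟨_, h⟩ | ⟨_, h⟩ <;> rcases h1' with ⟨_, h'⟩ | ⟨_, h'⟩
        · linarith
        · exact ⟨h, h'⟩
        · linarith
        · linarith
      · have := hmono r' r h hr
        exfalso
        rcases h1 with ⟨_, h⟩ | ⟨_, h⟩ <;> rcases h1' with ⟨_, h'⟩ | ⟨_, h'⟩ <;> linarith
    obtain ⟨r, hr, a, b⟩ := key i hi j hj e1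
    obtain ⟨r', hr', a', b'⟩ := key j hj k hk e2
    have h3 : ∀ q < m, (I.pairProblem hI L m hm).pairTime g q + 3 * I.p
        ≤ (I.pairProblem hI L m hm).pairTime g (q + 1) := fun q hq => by
      have := hg.pairTime_add_le (r := q) (s := q + 1) (by omega) hq
      rw [Nat.add_sub_cancel_left] at this
      change _ + 3 * I.p * _ ≤ _ at this
      simpa using this
    -- The middle job of a chain would start both `p` after the start of one pair and at the start
    -- of a pair, but pairs take at least `3 p`.
    rcases lt_trichotomy r r' with h | h | h
    · have := hmono r r' h hr'
      have := h3 r hr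
      linarith
    · subst h
      linarith
    · have := hmono r' r h hr
      have := h3 r' hr'
      linarith

theorem Follows.maxLatenessLE (hs : Follows (I.pairProblem hI L m hm) g s)
    (hg : (I.pairProblem hI L m hm).IsFeasible g) : I.MaxLatenessLE s L := by
  intro j hj
  obtain ⟨r, hr, h1, -⟩ := hs.job hg.arr hj
  simp only [completion]
  rcases h1 with ⟨e, h⟩ | ⟨e, h⟩
  · have a := hg.first r hr
    rw [← e] at a
    change _ ≤ I.d j + L - I.b j - 2 * I.p at a
    linarith
  · have a := hg.second r hr
    change _ + I.p ≤ (I.pairProblem hI L m hm).F (g (2 * m - r)) at a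
    rw [← e] at a
    change _ ≤ I.d j + L - I.b j - 2 * I.p at a
    linarith

theorem Follows.isMakespan (hs : Follows (I.pairProblem hI L m hm) g s)
    (hg : (I.pairProblem hI L m hm).IsArrangement g) (hm0 : 0 < m) :
    I.IsMakespan s ((I.pairProblem hI L m hm).pairTime g m) := by
  constructor
  · refine ⟨g (m + 1), ?_, ?_⟩
    · have a := hg.one_le (m + 1) (by omega) (show m + 1 ≤ 2 * m by omega)
      have b : g (m + 1) ≤ 2 * m := hg.le (m + 1) (by omega) (show m + 1 ≤ 2 * m by omega)
      simp only [jobs, Finset.mem_Icc]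
      omega
    · have a := hs.2 (m - 1) (show m - 1 < m by omega)
      change s (g (2 * m - (m - 1))) = _ + I.p at a
      rw [show 2 * m - (m - 1) = m + 1 by omega] at a
      have b := PairProblem.pairTime_last (P := I.pairProblem hI L m hm) (g := g) hm0
      change _ = (I.pairProblem hI L m hm).pairTime g (m - 1) + (3 * I.p + I.b (g (m + 1))) at b
      simp only [completion]
      rw [a]
      linarith [show (I.pairProblem hI L m hm).pairTime g m = _ from b]
  · rintro t ⟨j, hj, rfl⟩
    obtain ⟨r, hr, -, h, -⟩ := hs.job hg hj
    exact h.trans (hg.pairTime_mono hr le_rfl)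

end Follows

end CoupledInstance

/-! ### Pivots and trims of the instance in terms of arrangements. -/

namespace CoupledInstance
variable {I : CoupledInstance} {s : ℕ → ℝ} {L C : ℝ} {k i : ℕ}

/-- A feasible arrangement is a schedule, so it cannot end before `C`. The pivotal conditions are
monotone in the job number, hence they hold exactly from `n - k` and `n - i` on. -/
theorem IsShortest.isPivotal (hI : I.IsDisagreeableNoLong) {m : ℕ} (hm : I.n = 2 * m)
    (hs : I.IsShortest s L C) (hk : I.IsPivotK L C k) (hi : I.IsPivotI L C k i) :
    (I.pairProblem hI L m hm).IsPivotal C (I.n - k) (I.n - i) := by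
  obtain ⟨⟨hk1, hk2⟩, hk3⟩ := hk
  obtain ⟨⟨hi1, hi2, hi3⟩, hi4⟩ := hi
  have hm0 : 0 < m := by omega
  have hF : ∀ j, (I.pairProblem hI L m hm).F j = I.d j + L - I.b j - 2 * I.p := fun _ => rfl
  have hb : (I.pairProblem hI L m hm).b = I.b := rfl
  have hp : (I.pairProblem hI L m hm).p = I.p := rfl
  have hPm : (I.pairProblem hI L m hm).m = m := rfl
  refine ⟨fun g hg => ?_, by omega, by omega, by omega, fun j h1 h2 => ?_, fun j h1 h2 => ?_⟩
  · obtain ⟨s', hs'⟩ := exists_follows hg.arr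
    exact hs.shortest s' _ (hs'.isSchedule hg.arr) (hs'.maxLatenessLE hg)
      (hs'.isMakespan hg.arr hm0)
  · rw [hF, hb, hp]
    rw [hPm] at h2
    constructor
    · intro h
      have := hI.edd (I.n - k) (by simp [jobs]; omega) j (by simp [jobs]; omega) h
      linarith
    · intro h
      by_contra hcon
      have := hk3 (show I.n - j ∈ {k : ℕ | k < I.n ∧ C - I.d (I.n - k) ≤ L} from
        ⟨by omega, by rw [show I.n - (I.n - j) = j by omega]; linarith⟩)
      omega
  · rw [hb, hp]
    rw [hPm] at h2
    constructor
    · intro h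
      have a := (I.pairProblem hI L m hm).F_mono (I.n - i) j (by omega) h (by rw [hPm]; omega)
      rw [hF] at a
      linarith
    · intro h
      rw [hF] at h
      by_contra hcon
      have := hi4 (show I.n - j ∈ {i : ℕ | k < i ∧ i < I.n ∧
          C - I.p - I.b (I.n - k) + I.b (I.n - i) - I.d (I.n - i) ≤ L} from
        ⟨by omega, by omega, by rw [show I.n - (I.n - j) = j by omega]; linarith⟩)
      omega

theorem pairStart_sub (I : CoupledInstance) (C : ℝ) (y y' : ℕ → ℕ) (N e : ℕ) (he : e ≤ N)
    (h : ∀ q < e, y (N - 1 - q) = y' q) :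
    I.pairStart C y N (N - e) = C - ∑ q ∈ Finset.range e, (3 * I.p + I.b (y' q)) := by
  unfold pairStart
  congr 1
  rw [Finset.sum_Ico_eq_sum_range, ← Finset.sum_range_reflect]
  rw [show N - (N - e) = e by omega]
  refine Finset.sum_congr rfl fun q hq => ?_
  simp only [Finset.mem_range] at hq
  rw [← h q hq]
  congr 3
  omega

theorem trimSecond_eq_endSecond (I : CoupledInstance) {k i α β e : ℕ} (h : α + 2 * β + 1 = i)
    (hn : i + α < I.n) (hk : k < i) (he : e ≤ α + β) :
    I.trimSecond k i α β (α + β - e) = PairProblem.endSecond (I.n - k) (I.n - i + β) e := by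
  unfold trimSecond PairProblem.endSecond
  split_ifs <;> omega

theorem pairStart_trim (hI : I.IsDisagreeableNoLong) {m : ℕ} (hm : I.n = 2 * m) {α β e : ℕ}
    (h : α + 2 * β + 1 = i) (hn : i + α < I.n) (hk : k < i) (he : e ≤ α + β) :
    I.pairStart C (I.trimSecond k i α β) (α + β + 1) (α + β - e)
      = (I.pairProblem hI L m hm).trimTime C (I.n - k) (I.n - i + β) (e + 1) := by
  rw [show α + β - e = α + β + 1 - (e + 1) by omega]
  exact I.pairStart_sub C _ _ _ _ (by omega) fun q hq =>
    I.trimSecond_eq_endSecond h hn hk (by omega)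

/-- With `t = n - i + β`, the bound `m ≤ t` expresses `i + α < n`, and `2 t + 1 ≤ 2 m + (n - i)`
expresses `α ≥ 0`. -/
theorem IsFeasibleTrim.pairProblem (hI : I.IsDisagreeableNoLong) {m : ℕ} (hm : I.n = 2 * m)
    (hk : k < i) {α β : ℕ} (h : I.IsFeasibleTrim L C k i α β) :
    (I.pairProblem hI L m hm).IsFeasibleTrim C (I.n - k) (I.n - i) (I.n - i + β) := by
  obtain ⟨h1, h2, h3⟩ := h
  refine ⟨show m ≤ _ by omega, by omega, show _ ≤ 2 * m + _ by omega, fun e he => ?_⟩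
  have he' : I.n - i + β + e + 1 ≤ 2 * m := he
  have a := (h3 (α + β - e) (by omega)).1
  rw [pairStart_trim hI hm h1 h2 hk (by omega) (L := L)] at a
  have e1 : I.trimFirst i α (α + β - e) = I.n - i + β - e := by unfold trimFirst; omega
  rw [e1] at a
  show _ ≤ I.d _ + L - I.b _ - 2 * I.p
  linarith

theorem IsFeasibleTrim.of_pairProblem (hI : I.IsDisagreeableNoLong) {m : ℕ} (hm : I.n = 2 * m)
    (hk : k < i) (hP : (I.pairProblem hI L m hm).IsPivotal C (I.n - k) (I.n - i)) {α β : ℕ}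
    (h1 : α + 2 * β + 1 = i) (h2 : i + α < I.n)
    (h : (I.pairProblem hI L m hm).IsFeasibleTrim C (I.n - k) (I.n - i) (I.n - i + β)) :
    I.IsFeasibleTrim L C k i α β := by
  refine ⟨h1, h2, fun r hr => ?_⟩
  obtain ⟨e, he, rfl⟩ : ∃ e ≤ α + β, r = α + β - e := ⟨α + β - r, by omega, by omega⟩
  rw [pairStart_trim hI hm h1 h2 hk he (L := L), I.trimSecond_eq_endSecond h1 h2 hk he]
  have e1 : I.trimFirst i α (α + β - e) = I.n - i + β - e := by unfold trimFirst; omega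
  have hr' : I.n - i + β + e + 1 ≤ 2 * m := by omega
  have a := h.first e hr'
  -- The second jobs are on time for any trim, which is why feasibility in the arrangement problem
  -- mentions first jobs only.
  have b := hP.trim_second (t := I.n - i + β) (e := e) (by omega) hr'
  change _ ≤ I.d _ + L - I.b _ - 2 * I.p at a
  change _ + I.p ≤ I.d _ + L - I.b _ - 2 * I.p at b
  rw [e1]
  constructor <;> linarith

theorem Follows.endsWithTrimEnd {hI : I.IsDisagreeableNoLong} {m : ℕ} {hm : I.n = 2 * m}
    {g : ℕ → ℕ} (hs : Follows (I.pairProblem hI L m hm) g s)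
    (hg : (I.pairProblem hI L m hm).IsArrangement g)
    (hC : (I.pairProblem hI L m hm).pairTime g m = C) {α β : ℕ} (h1 : α + 2 * β + 1 = i)
    (h2 : i + α < I.n) (hk : k < i)
    (hend : ∀ e ≤ β, e < m ∧ g (m - e) = I.n - i + β - e ∧
      g (m + 1 + e) = PairProblem.endSecond (I.n - k) (I.n - i + β) e) :
    I.EndsWithTrimEnd s C k i α β := by
  have hstart : ∀ e ≤ β, I.pairStart C (fun r => I.trimSecond k i α β (α + r)) (β + 1) (β - e)
      = (I.pairProblem hI L m hm).pairTime g (m - (e + 1)) := by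
    intro e he
    rw [show β - e = β + 1 - (e + 1) by omega]
    have a := PairProblem.pairTime_eq_sub (P := I.pairProblem hI L m hm) g (e := e + 1)
      (hend e he).1
    change (I.pairProblem hI L m hm).pairTime g (m - (e + 1)) =
      (I.pairProblem hI L m hm).pairTime g m -
        ∑ q ∈ Finset.range (e + 1), (3 * I.p + I.b (g (m + 1 + q))) at a
    rw [a, hC]
    refine I.pairStart_sub C _ (fun q => g (m + 1 + q)) _ _ (by omega) fun q hq => ?_
    rw [(hend q (by omega)).2.2, ← I.trimSecond_eq_endSecond h1 h2 hk (by omega)]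
    congr 1
    omega
  constructor
  · intro r hr
    obtain ⟨e, he, rfl⟩ : ∃ e ≤ β, r = β - e := ⟨β - r, by omega, by omega⟩
    obtain ⟨a1, a2, a3⟩ := hend e he
    rw [hstart e he]
    have b1 := hs.1 (m - (e + 1)) (show m - (e + 1) < m by omega)
    have b2 := hs.2 (m - (e + 1)) (show m - (e + 1) < m by omega)
    change s (g (2 * m - (m - (e + 1)))) = _ + I.p at b2
    rw [show m - (e + 1) + 1 = m - e by omega, a2] at b1
    rw [show 2 * m - (m - (e + 1)) = m + 1 + e by omega, a3] at b2
    have e1 : I.trimFirst i α (α + (β - e)) = I.n - i + β - e := by unfold trimFirst; omega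
    have e2 : α + (β - e) = α + β - e := by omega
    simp only
    rw [e1, e2, I.trimSecond_eq_endSecond h1 h2 hk (by omega)]
    exact ⟨b1, b2⟩
  · intro j hj hne
    obtain ⟨r, hr, hj1, hj2, -⟩ := hs.job hg hj
    have h0 := hstart β le_rfl
    rw [Nat.sub_self] at h0
    rw [h0]
    have hlt := (hend β le_rfl).1
    rcases Nat.lt_or_ge r (m - (β + 1)) with h | h
    · exact hj2.trans (hg.pairTime_mono h (show m - (β + 1) ≤ m by omega))
    · exfalso
      obtain ⟨e, he, rfl⟩ : ∃ e ≤ β, r = m - (e + 1) := ⟨m - (r + 1), by omega, by omega⟩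
      obtain ⟨a1, a2, a3⟩ := hend e he
      obtain ⟨c1, c2⟩ := hne (β - e) (by omega)
      have e1 : I.trimFirst i α (α + (β - e)) = I.n - i + β - e := by unfold trimFirst; omega
      have e2 : α + (β - e) = α + β - e := by omega
      simp only at c1 c2
      rw [e1] at c1
      rw [e2, I.trimSecond_eq_endSecond h1 h2 hk (by omega)] at c2
      rcases hj1 with ⟨d, _⟩ | ⟨d, _⟩
      · rw [show m - (e + 1) + 1 = m - e by omega, a2] at d
        exact c1 d
      · rw [show 2 * m - (m - (e + 1)) = m + 1 + e by omega, a3] at d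
        exact c2 d

end CoupledInstance

theorem lemma25 (I : CoupledInstance) (hI : I.IsDisagreeableNoLong) (hn : Even I.n)
    (L C : ℝ) (s : ℕ → ℝ) (hs : I.IsShortest s L C)
    (k i : ℕ) (hk : I.IsPivotK L C k) (hi : I.IsPivotI L C k i) :
    ∃ α β : ℕ, I.IsOptimalTrim L C k i α β ∧
      ∃ s' : ℕ → ℝ, I.IsShortest s' L C ∧ I.EndsWithTrimEnd s' C k i α β := by
  obtain ⟨m, hm⟩ := hn
  replace hm : I.n = 2 * m := by omega
  have hki : k < i := hi.1.1
  have hin : i < I.n := hi.1.2.1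
  have hm0 : 0 < m := by omega
  have hP := hs.isPivotal hI hm hk hi
  have hex := hs.isSchedule.exists_arrangement hI hs.lateness
    (fun j hj => hs.makespan.2 ⟨j, hj, rfl⟩) hm hm0
  obtain ⟨g, t, hg, hgC, htrim, hmin, hend⟩ := hP.exists_arrangement hex
  have t1 : m ≤ t := htrim.m_le
  have t2 := htrim.M_le
  have t3 : 2 * t + 1 ≤ 2 * m + (I.n - i) := htrim.le
  obtain ⟨β, rfl⟩ : ∃ β, t = I.n - i + β := ⟨t - (I.n - i), by omega⟩
  obtain ⟨α, hα⟩ : ∃ α, α + 2 * β + 1 = i := ⟨i - (2 * β + 1), by omega⟩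
  have hαn : i + α < I.n := by omega
  refine ⟨α, β, ⟨CoupledInstance.IsFeasibleTrim.of_pairProblem hI hm hki hP hα hαn htrim,
    fun α' β' h' => ?_⟩, ?_⟩
  -- `α + 2 β + 1 = i`, so minimality of `t = n - i + β` is maximality of `α`.
  · have := hmin _ (h'.pairProblem hI hm hki)
    have := h'.1
    omega
  · obtain ⟨s', hs'⟩ := CoupledInstance.exists_follows hg.arr
    have hmake := hs'.isMakespan hg.arr hm0
    replace hgC : (I.pairProblem hI L m hm).pairTime g m = C := hgC
    rw [hgC] at hmake
    exact ⟨s', ⟨hs'.isSchedule hg.arr, hs'.maxLatenessLE hg, hmake, hs.shortest⟩,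
      hs'.endsWithTrimEnd hg.arr hgC hα hαn hki fun e he => hend e (by omega)⟩
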